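/- Let $\mathcal A,\mathcal B,\mathcal E$ be finite alphabets and let $(A_i,B_i,E_i)$, $i\ge 1$, be i.i.d. with the law $p_{A,B,E}$ of a triple $(A,B,E)$ on $\mathcal A\times\mathcal B\times\mathcal E$. All entropies are in bits. For $R\in\mathbb R$ and an integer $N\ge 1$, an $(R,N)$ code consists of an encoder $f:\mathcal A^N\to\{1,\dots,\lfloor 2^{NR}\rfloor\}$ for Alice and a decoder $g:\{1,\dots,\lfloor 2^{NR}\rfloor\}\times\mathcal B^N\to\mathcal A^N$ for Bob, who has the uncoded side information $B^N$. Its error probability is $P_e^N=\Pr\big(g(f(A^N),B^N)\ne A^N\big)$, and its equivocation at the eavesdropper Eve, who observes $f(A^N)$ and $E^N$, is $H(A^N\mid f(A^N),E^N)$. A pair $(R_A,\Delta)\in\mathbb R^2$ is called achievable if for every $\epsilon>0$ there are an $N\ge1$ and an $(R_A+\epsilon,N)$ code with $$H(A^N\mid f(A^N),E^N)\ \ge\ N(\Delta-\epsilon)\qquad\text{and}\qquad P_e^N<\epsilon .$$ Then $(R_A,\Delta)$ is achievable if and only if $$R_A\ \ge\ H(A\mid B)\qquad\text{and}\qquad \Delta\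 \le\ \max\,\{\,I(A;B\mid U)-I(A;E\mid U)\,\},$$ where the maximum, which is attained, is over all auxiliary random variables $U$, jointly distributed with $(A,B,E)$, such that $U-A-(B,E)$ is a Markov chain and $U$ takes values in a finite set $\mathcal U$ with $|\mathcal U|\le|\mathcal A|+1$. -/

import Mathlib

namespace SecureCompression

noncomputable section

/-- The probability of an event under a probability mass function, as a real number. -/
def prob {Ω : Type*} (p : PMF Ω) (s : Set Ω) : ℝ := (p.toOuterMeasure s).toReal

/-- Conditional entropy in bits,
`H(X | Y) = -∑ P(X = x, Y = y) log₂ (P(X = x, Y = y) / P(Y = y))`, with `0 log 0 = 0`;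
a term with `P(Y = y) = 0` is zero since then `P(X = x, Y = y) = 0`. -/
def condEntropy {Ω S T : Type*} [Fintype S] [Fintype T] (p : PMF Ω) (X : Ω → S) (Y : Ω → T) : ℝ :=
  -∑ x : S, ∑ y : T, prob p {ω | X ω = x ∧ Y ω = y} *
    Real.logb 2 (prob p {ω | X ω = x ∧ Y ω = y} / prob p {ω | Y ω = y})

/-- Conditional mutual information `I(X; Y | Z) = H(X | Z) - H(X | Y, Z)` in bits. -/
def condMutualInfo {Ω S T V : Type*} [Fintype S] [Fintype T] [Fintype V]
    (p : PMF Ω) (X : Ω → S) (Y : Ω → T) (Z : Ω → V) : ℝ :=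
  condEntropy p X Z - condEntropy p X (fun ω => (Y ω, Z ω))

/-- `X - Y - Z` is a Markov chain: `X` and `Z` are conditionally independent given `Y`, that is
`P(x, y, z) P(y) = P(x, y) P(y, z)` for all values. -/
def IsMarkovChain {Ω S T V : Type*} (p : PMF Ω) (X : Ω → S) (Y : Ω → T) (Z : Ω → V) : Prop :=
  ∀ (x : S) (y : T) (z : V),
    prob p {ω | X ω = x ∧ Y ω = y ∧ Z ω = z} * prob p {ω | Y ω = y} =
      prob p {ω | X ω = x ∧ Y ω = y} * prob p {ω | Y ω = y ∧ Z ω = z}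

/-- The law of `N` independent draws from `p`: `x ↦ ∏ᵢ p(xᵢ)`. -/
def iid {X : Type*} [Fintype X] (p : PMF X) (N : ℕ) : PMF (Fin N → X) :=
  PMF.ofFintype (fun x => ∏ i, p (x i)) (by
    classical
    have h : ∑ a : X, p a = 1 := by
      rw [← tsum_fintype (L := .unconditional X)]
      exact p.tsum_coe
    rw [← Fintype.piFinset_univ, ← Finset.prod_univ_sum (fun _ : Fin N => (Finset.univ : Finset X))
      (fun _ a => p a)]
    simp [h])

variable {𝒜 ℬ ℰ : Type*}

/-- The source sequence `A^N` within a block of `N` triples. -/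
def seqA {N : ℕ} (ω : Fin N → 𝒜 × ℬ × ℰ) : Fin N → 𝒜 := fun i => (ω i).1

/-- Bob's side information sequence `B^N`. -/
def seqB {N : ℕ} (ω : Fin N → 𝒜 × ℬ × ℰ) : Fin N → ℬ := fun i => (ω i).2.1

/-- Eve's side information sequence `E^N`. -/
def seqE {N : ℕ} (ω : Fin N → 𝒜 × ℬ × ℰ) : Fin N → ℰ := fun i => (ω i).2.2

/-- An `(R, N)` code for uncoded side information at Bob: Alice's encoder
`𝒜^N → {1, …, ⌊2^(N R)⌋}` and Bob's decoder `{1, …, ⌊2^(N R)⌋} × ℬ^N → 𝒜^N`. -/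
structure Code (𝒜 ℬ : Type*) (R : ℝ) (N : ℕ) where
  /-- Alice's encoder. -/
  enc : (Fin N → 𝒜) → Fin ⌊(2 : ℝ) ^ ((N : ℝ) * R)⌋₊
  /-- Bob's decoder. -/
  dec : Fin ⌊(2 : ℝ) ^ ((N : ℝ) * R)⌋₊ × (Fin N → ℬ) → (Fin N → 𝒜)

/-- The error probability `P(g(f(A^N), B^N) ≠ A^N)` of a code. -/
def Code.errorProb {R : ℝ} {N : ℕ} [Fintype 𝒜] [Fintype ℬ] [Fintype ℰ]
    (c : Code 𝒜 ℬ R N) (p : PMF (𝒜 × ℬ × ℰ)) : ℝ :=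
  prob (iid p N) {ω | c.dec (c.enc (seqA ω), seqB ω) ≠ seqA ω}

/-- The (unnormalized) equivocation `H(A^N | f(A^N), E^N)` at Eve, in bits. -/
def Code.equivocation {R : ℝ} {N : ℕ} [Fintype 𝒜] [Fintype ℬ] [Fintype ℰ]
    (c : Code 𝒜 ℬ R N) (p : PMF (𝒜 × ℬ × ℰ)) : ℝ :=
  condEntropy (iid p N) seqA (fun ω => (c.enc (seqA ω), seqE ω))

/-- The rate-equivocation pair `(R, Δ)` is achievable: for every `ε > 0` there is a code, of some
block length `N ≥ 1`, with rate at most `R + ε`, equivocation at least `N (Δ - ε)` and error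
probability below `ε`. -/
def Achievable [Fintype 𝒜] [Fintype ℬ] [Fintype ℰ] (p : PMF (𝒜 × ℬ × ℰ)) (R Δ : ℝ) : Prop :=
  ∀ ε : ℝ, 0 < ε → ∃ N : ℕ, 1 ≤ N ∧ ∃ c : Code 𝒜 ℬ (R + ε) N,
    (N : ℝ) * (Δ - ε) ≤ c.equivocation p ∧ c.errorProb p < ε

/-- `q` is the joint law of `(U, A, B, E)`, where `(A, B, E)` has law `p` and
`U - A - (B, E)` is a Markov chain. -/
def IsAuxiliary {𝒰 : Type*} (p : PMF (𝒜 × ℬ × ℰ)) (q : PMF (𝒰 × 𝒜 × ℬ × ℰ)) : Prop :=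
  q.map Prod.snd = p ∧ IsMarkovChain q (fun ω => ω.1) (fun ω => ω.2.1) (fun ω => ω.2.2)

/-- The values of `I(A; B | U) - I(A; E | U)` over all auxiliary `U` with `|𝒰| ≤ |𝒜| + 1` and
`U - A - (B, E)` a Markov chain. -/
def equivocationValues [Fintype 𝒜] [Fintype ℬ] [Fintype ℰ] (p : PMF (𝒜 × ℬ × ℰ)) : Set ℝ :=
  {r | ∃ k : ℕ, k ≤ Fintype.card 𝒜 + 1 ∧ ∃ q : PMF (Fin k × 𝒜 × ℬ × ℰ), IsAuxiliary p q ∧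
    r = condMutualInfo q (fun ω => ω.2.1) (fun ω => ω.2.2.1) (fun ω => ω.1)
      - condMutualInfo q (fun ω => ω.2.1) (fun ω => ω.2.2.2) (fun ω => ω.1)}

end

end SecureCompression

/-!
An auxiliary variable `U` with `U - A - (B, E)` is a channel `k` with input `A`; its value is
`I(A; B | U) - I(A; E | U) = H(A | U, E) - H(A | U, B)`. Up to a constant the value is a sum over
the letters `u` of a continuous, homogeneous function of the column `k(u | ·)`. Continuity and
compactness give a maximum among channels with `|𝒜| + 1` outputs (`exists_optimal_channel`), and
homogeneity lets Carathéodory's argument reduce any channel to that size (`exists_columns`).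

Converse. If the index is `J`, Fano's inequality makes `H(A^N | J, B^N)` negligible, so the
equivocation is essentially `H(A^N | J, E^N) - H(A^N | J, B^N)`. Replacing `E^N` by `B^N` one letter
at a time, this difference telescopes into `N` values of auxiliary channels, the auxiliary variable
at time `i` being `(J, B^{<i}, E^{>i})` (`cent_sub_cent_le`).

Direct part. For a deterministic auxiliary `V = v(A)`, the encoder bins the words of `V` at rate
`H(V | B)` and the source words at rate `H(A | V, B)`, in total `H(A | B)`. Eve learns at most
`H(V | E) + H(A | V, B)` bits per letter, and what is left of `H(A | E)` is
`H(A | V, E) - H(A | V, B)` (`exists_code_of_function`). No Wyner-Ziv coding is needed for a random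
`U`: on long blocks it can be replaced by a deterministic function of the source without loss
(`exists_quantizer`). By Gibbs' inequality `H(V | E) + H(A | V, B)` is at most a sum of two cross
entropies, which is the average of an additive cost of the pair (codeword, source word) plus the
rate of the codebook; a random codebook of rate slightly above `I(A; U)` contains, for most source
words, a codeword of cost at most the single-letter mean. Applying the deterministic scheme to
blocks of blocks gives the codes. The cross entropies are finite because the channel may be assumed
to have full support (`exists_full_support`).

Entropies are handled as expectations of `-log₂ P(X)` under real weights in the standard simplex.
-/

namespace SecureCompression

open Finset

/-! ### Finite weights, entropy and Gibbs' inequality -/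

section Weights

variable {Ω S T V : Type*} [Fintype Ω]

open scoped Classical in
/-- The probability of an event under the weights `m`. -/
noncomputable def pr (m : Ω → ℝ) (P : Ω → Prop) : ℝ := ∑ ω, if P ω then m ω else 0

/-- The law of the random variable `X` under the weights `m`. -/
noncomputable def push (m : Ω → ℝ) (X : Ω → S) (x : S) : ℝ := pr m fun ω => X ω = x

/-- Entropy in bits, written as the expectation of `-log₂ P(X)`. As the sum runs over the sample
space, the alphabet of `X` need not be finite and only the partition generated by `X` matters. -/
noncomputable def ent (m : Ω → ℝ) (X : Ω → S) : ℝ := ∑ ω, m ω * -Real.logb 2 (push m X (X ω))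

/-- Conditional entropy `H(X | Y) = H(X, Y) - H(Y)` in bits. -/
noncomputable def cent (m : Ω → ℝ) (X : Ω → S) (Y : Ω → T) : ℝ :=
  ent m (fun ω => (X ω, Y ω)) - ent m Y

variable {m : Ω → ℝ}

lemma pr_nonneg (hm : ∀ ω, 0 ≤ m ω) (P : Ω → Prop) : 0 ≤ pr m P := by
  refine sum_nonneg fun ω _ => ?_
  split_ifs <;> simp [hm]

lemma pr_mono (hm : ∀ ω, 0 ≤ m ω) {P Q : Ω → Prop} (h : ∀ ω, 0 < m ω → P ω → Q ω) :
    pr m P ≤ pr m Q := by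
  refine sum_le_sum fun ω _ => ?_
  rcases (hm ω).eq_or_lt with h0 | h0
  · simp [← h0]
  · by_cases hP : P ω
    · simp [hP, h ω h0 hP]
    · split_ifs <;> simp [hm]

lemma pr_or_le (hm : ∀ ω, 0 ≤ m ω) (P Q : Ω → Prop) :
    pr m (fun ω => P ω ∨ Q ω) ≤ pr m P + pr m Q := by
  rw [pr, pr, pr, ← sum_add_distrib]
  refine sum_le_sum fun ω _ => ?_
  have := hm ω
  by_cases hP : P ω <;> by_cases hQ : Q ω <;> simp [hP, hQ, this]

lemma pr_eq_sum_mul (P : Ω → Prop) [DecidablePred P] :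
    pr m P = ∑ ω, m ω * if P ω then 1 else 0 := by
  refine sum_congr rfl fun ω _ => ?_
  by_cases hP : P ω <;> simp [hP]

lemma pr_le_one (hm : m ∈ stdSimplex ℝ Ω) (P : Ω → Prop) : pr m P ≤ 1 := by
  rw [← hm.2]
  refine sum_le_sum fun ω _ => ?_
  have := hm.1 ω
  split_ifs <;> simp [this]

lemma pr_add_pr_not (hm : m ∈ stdSimplex ℝ Ω) (P : Ω → Prop) :
    pr m P + pr m (fun ω => ¬ P ω) = 1 := by
  rw [← hm.2, pr, pr, ← sum_add_distrib]
  refine sum_congr rfl fun ω _ => ?_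
  by_cases hP : P ω <;> simp [hP]

/-- Some value is at most the average. -/
lemma exists_le_of_sum_mul_le (hm : m ∈ stdSimplex ℝ Ω) {f : Ω → ℝ} {c : ℝ}
    (h : ∑ ω, m ω * f ω ≤ c) : ∃ ω, f ω ≤ c := by
  by_contra! hc
  have h1 : ∑ ω, m ω * c ≤ ∑ ω, m ω * f ω :=
    sum_le_sum fun ω _ => mul_le_mul_of_nonneg_left (hc ω).le (hm.1 ω)
  rw [← sum_mul, hm.2, one_mul] at h1
  have h2 : ∑ ω, m ω * (f ω - c) = 0 := by
    simp only [mul_sub, sum_sub_distrib, ← sum_mul, hm.2]; linarith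
  have h3 := (sum_eq_zero_iff_of_nonneg fun ω _ =>
    mul_nonneg (hm.1 ω) (sub_nonneg.2 (hc ω).le)).1 h2
  have h4 : ∑ ω, m ω = 0 := sum_eq_zero fun ω hω => by
    rcases mul_eq_zero.1 (h3 ω hω) with h | h
    · exact h
    · linarith [hc ω]
  linarith [hm.2]

lemma push_nonneg (hm : ∀ ω, 0 ≤ m ω) (X : Ω → S) (x : S) : 0 ≤ push m X x := pr_nonneg hm _

lemma le_push (hm : ∀ ω, 0 ≤ m ω) (X : Ω → S) (ω : Ω) : m ω ≤ push m X (X ω) := by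
  classical
  have := single_le_sum (f := fun ω' => if X ω' = X ω then m ω' else 0)
    (fun ω' _ => by split_ifs <;> simp [hm]) (mem_univ ω)
  simpa [push, pr] using this

lemma push_pos (hm : ∀ ω, 0 ≤ m ω) (X : Ω → S) {ω : Ω} (h : 0 < m ω) : 0 < push m X (X ω) :=
  h.trans_le (le_push hm X ω)

lemma push_id : push m (fun ω => ω) = m := by
  classical
  ext x; simp [push, pr]

lemma sum_push_mul [Fintype S] (X : Ω → S) (f : S → ℝ) :
    ∑ x, push m X x * f x = ∑ ω, m ω * f (X ω) := by
  classical
  simp only [push, pr, sum_mul]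
  rw [sum_comm]
  refine sum_congr rfl fun ω _ => ?_
  simp [ite_mul]

lemma push_mem [Fintype S] (hm : m ∈ stdSimplex ℝ Ω) (X : Ω → S) : push m X ∈ stdSimplex ℝ S :=
  ⟨push_nonneg hm.1 X, by simpa [hm.2] using sum_push_mul (m := m) X fun _ => 1⟩

lemma pr_push [Fintype S] (X : Ω → S) (P : S → Prop) :
    pr (push m X) P = pr m fun ω => P (X ω) := by
  classical
  rw [pr_eq_sum_mul, sum_push_mul, pr_eq_sum_mul]

lemma push_push [Fintype S] (X : Ω → S) (Y : S → T) :
    push (push m X) Y = push m fun ω => Y (X ω) := by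
  ext y; exact pr_push X _

lemma push_le_push (hm : ∀ ω, 0 ≤ m ω) {X : Ω → S} {Y : Ω → T} {x : S} {y : T}
    (h : ∀ ω, X ω = x → Y ω = y) : push m X x ≤ push m Y y :=
  pr_mono hm fun ω _ => h ω

lemma ent_congr {X : Ω → S} {Y : Ω → T} (h : ∀ ω ω', X ω = X ω' ↔ Y ω = Y ω') :
    ent m X = ent m Y := by
  refine sum_congr rfl fun ω _ => ?_
  simp only [push, h]

lemma ent_push [Fintype S] (X : Ω → S) (Y : S → T) :
    ent (push m X) Y = ent m fun ω => Y (X ω) := by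
  rw [ent, sum_push_mul, push_push]; rfl

lemma cent_push [Fintype S] (X : Ω → S) (Y : S → T) (Z : S → V) :
    cent (push m X) Y Z = cent m (fun ω => Y (X ω)) (fun ω => Z (X ω)) := by
  rw [cent, ent_push, ent_push]; rfl

lemma ent_le_ent (hm : ∀ ω, 0 ≤ m ω) {X : Ω → S} {Y : Ω → T}
    (h : ∀ ω ω', X ω = X ω' → Y ω = Y ω') : ent m Y ≤ ent m X := by
  refine sum_le_sum fun ω _ => ?_
  rcases (hm ω).eq_or_lt with h0 | h0
  · simp [← h0]
  refine mul_le_mul_of_nonneg_left (neg_le_neg ?_) h0.le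
  exact Real.logb_le_logb_of_le one_lt_two (push_pos hm X h0)
    (push_le_push hm fun ω' => h ω' ω)

lemma cent_nonneg (hm : ∀ ω, 0 ≤ m ω) (X : Ω → S) (Y : Ω → T) : 0 ≤ cent m X Y :=
  sub_nonneg.2 (ent_le_ent hm fun _ _ h => (Prod.ext_iff.1 h).2)

/-- Gibbs' inequality: the conditional entropy is at most any cross entropy. The kernel `q` is
normalised only on average, by the constant `c`. -/
lemma cent_le_cross [Fintype S] [Fintype T] (hm : m ∈ stdSimplex ℝ Ω) (X : Ω → S) (Y : Ω → T)
    (q : S → T → ℝ) (hq : ∀ x y, 0 ≤ q x y) (hq' : ∀ ω, 0 < m ω → 0 < q (X ω) (Y ω)) {c : ℝ}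
    (hc : 0 < c) (hqc : ∑ y, push m Y y * ∑ x, q x y ≤ c) :
    cent m X Y ≤ ∑ ω, m ω * -Real.logb 2 (q (X ω) (Y ω)) + Real.logb 2 c := by
  set Z : Ω → S × T := fun ω => (X ω, Y ω) with hZ
  have hl : (0:ℝ) < Real.log 2 := Real.log_pos one_lt_two
  have key : ∀ ω, m ω * (-Real.logb 2 (push m Z (Z ω)) - -Real.logb 2 (push m Y (Y ω))
      - -Real.logb 2 (q (X ω) (Y ω)) - Real.logb 2 c) ≤
      m ω * ((q (X ω) (Y ω) * push m Y (Y ω) / push m Z (Z ω) / c - 1) / Real.log 2) := by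
    intro ω
    rcases (hm.1 ω).eq_or_lt with h0 | h0
    · simp [← h0]
    refine mul_le_mul_of_nonneg_left ?_ h0.le
    have h1 := push_pos hm.1 Z h0
    have h2 := push_pos hm.1 Y h0
    have h3 := hq' ω h0
    have h4 : 0 < q (X ω) (Y ω) * push m Y (Y ω) / push m Z (Z ω) / c := by positivity
    have h5 := Real.log_le_sub_one_of_pos h4
    rw [Real.log_div (by positivity) hc.ne', Real.log_div (by positivity) h1.ne',
      Real.log_mul h3.ne' h2.ne'] at h5
    simp only [Real.logb]
    rw [le_div_iff₀ hl]
    refine le_trans (le_of_eq ?_) h5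
    field_simp
    ring
  have h6 := sum_le_sum fun ω (_ : ω ∈ univ) => key ω
  -- off the support of `Z` the quotient is zero, which only helps
  have h7 : ∑ ω, m ω * (q (X ω) (Y ω) * push m Y (Y ω) / push m Z (Z ω)) ≤ c := by
    rw [← sum_push_mul Z fun z => q z.1 z.2 * push m Y z.2 / push m Z z]
    refine le_trans (sum_le_sum (g := fun z => q z.1 z.2 * push m Y z.2) fun z _ => ?_)
      (le_trans (le_of_eq ?_) hqc)
    · rcases (push_nonneg hm.1 Z z).eq_or_lt with h0 | h0
      · simpa [← h0] using mul_nonneg (hq _ _) (push_nonneg hm.1 _ _)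
      · exact (mul_div_cancel₀ _ h0.ne').le
    · rw [Fintype.sum_prod_type_right]
      refine sum_congr rfl fun y _ => ?_
      rw [mul_sum]
      exact sum_congr rfl fun x _ => mul_comm _ _
  have h8 : ∑ ω, m ω * ((q (X ω) (Y ω) * push m Y (Y ω) / push m Z (Z ω) / c - 1) / Real.log 2)
      = ((∑ ω, m ω * (q (X ω) (Y ω) * push m Y (Y ω) / push m Z (Z ω))) / c - 1) / Real.log 2 := by
    trans ((∑ ω, m ω * (q (X ω) (Y ω) * push m Y (Y ω) / push m Z (Z ω))) / c
      - ∑ ω, m ω) / Real.log 2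
    · rw [sum_div, ← sum_sub_distrib, sum_div]
      exact sum_congr rfl fun ω _ => by ring
    · rw [hm.2]
  rw [h8] at h6
  have h9 : ((∑ ω, m ω * (q (X ω) (Y ω) * push m Y (Y ω) / push m Z (Z ω))) / c - 1)
      / Real.log 2 ≤ 0 := by
    refine div_nonpos_of_nonpos_of_nonneg ?_ hl.le
    rw [sub_nonpos, div_le_one hc]
    exact h7
  have h10 : ∑ ω, m ω * (-Real.logb 2 (push m Z (Z ω)) - -Real.logb 2 (push m Y (Y ω))
      - -Real.logb 2 (q (X ω) (Y ω)) - Real.logb 2 c) =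
      cent m X Y - ∑ ω, m ω * -Real.logb 2 (q (X ω) (Y ω)) - Real.logb 2 c := by
    simp only [mul_sub, sum_sub_distrib, ← sum_mul, hm.2, cent, ent, one_mul, hZ]
  linarith

lemma cent_le_cross_one [Fintype S] [Fintype T] (hm : m ∈ stdSimplex ℝ Ω) (X : Ω → S) (Y : Ω → T)
    (q : S → T → ℝ) (hq : ∀ x y, 0 ≤ q x y) (hq' : ∀ ω, 0 < m ω → 0 < q (X ω) (Y ω))
    (hqc : ∀ y, ∑ x, q x y ≤ 1) :
    cent m X Y ≤ ∑ ω, m ω * -Real.logb 2 (q (X ω) (Y ω)) := by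
  have := cent_le_cross hm X Y q hq hq' one_pos ?_
  · simpa using this
  · rw [← (push_mem hm Y).2]
    exact sum_le_sum fun y _ => mul_le_of_le_one_right (push_nonneg hm.1 _ _) (hqc y)

lemma cent_le_logb_card [Fintype S] [Fintype T] (hm : m ∈ stdSimplex ℝ Ω) (X : Ω → S)
    (Y : Ω → T) : cent m X Y ≤ Real.logb 2 (Fintype.card S) := by
  rcases isEmpty_or_nonempty S with hS | hS
  · have : IsEmpty Ω := ⟨fun ω => hS.elim (X ω)⟩
    have := hm.2
    simp at this
  have hc : (0:ℝ) < Fintype.card S := by exact_mod_cast Fintype.card_pos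
  have := cent_le_cross_one hm X Y (fun _ _ => (Fintype.card S : ℝ)⁻¹) (fun _ _ => by positivity)
    (fun _ _ => by positivity) (fun y => by simp [hc.ne'])
  simpa [← sum_mul, hm.2, Real.logb_inv] using this

/-- The conditional law of `X` given `Z` has total mass at most one (zero off the support). -/
lemma sum_push_pair_div_le [Fintype S] (X : Ω → S) (Z : Ω → V) (z : V) :
    ∑ x, push m (fun ω => (X ω, Z ω)) (x, z) / push m Z z ≤ 1 := by
  have : ∑ x, push m (fun ω => (X ω, Z ω)) (x, z) = push m Z z := by
    classical
    simp only [push, pr, Prod.ext_iff]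
    rw [sum_comm]
    refine sum_congr rfl fun ω _ => ?_
    by_cases h : Z ω = z <;> simp [h]
  rw [← sum_div, this]
  exact div_self_le_one _

/-- Fano's inequality, obtained from Gibbs' inequality with the kernel that trusts the estimate
`g Y` with probability `1 - ε`. -/
lemma fano [Fintype S] [Fintype T] (hm : m ∈ stdSimplex ℝ Ω) (X : Ω → S) (Y : Ω → T)
    (g : T → S) {ε : ℝ} (h0 : 0 < ε) (h1 : ε < 1) (hg : pr m (fun ω => g (Y ω) ≠ X ω) ≤ ε) :
    cent m X Y ≤ -Real.logb 2 (1 - ε) + ε * -Real.logb 2 ε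
      + ε * Real.logb 2 (Fintype.card S) := by
  classical
  rcases isEmpty_or_nonempty S with hS | hS
  · have : IsEmpty Ω := ⟨fun ω => hS.elim (X ω)⟩
    have := hm.2
    simp at this
  have hc : (1:ℝ) ≤ Fintype.card S := by exact_mod_cast Fintype.card_pos
  have hc0 : (0:ℝ) < Fintype.card S := by linarith
  have := cent_le_cross_one hm X Y
    (fun x y => if g y = x then 1 - ε else ε / Fintype.card S)
    (fun x y => by split_ifs <;> [linarith; positivity])
    (fun ω _ => by split_ifs <;> [linarith; positivity])
    (fun y => by
      calc ∑ x, (if g y = x then 1 - ε else ε / Fintype.card S)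
          ≤ ∑ x, ((if g y = x then 1 - ε else 0) + ε / Fintype.card S) := by
            refine sum_le_sum fun x _ => ?_
            split_ifs
            · have : 0 < ε / Fintype.card S := by positivity
              linarith
            · simp
        _ = 1 := by
            rw [sum_add_distrib]
            simp [mul_div_cancel₀ _ hc0.ne'])
  refine this.trans ?_
  have hl1 : 0 ≤ -Real.logb 2 (1 - ε) := by
    rw [neg_nonneg]
    exact Real.logb_nonpos one_lt_two (by linarith) (by linarith)
  have hl2 : 0 ≤ -Real.logb 2 ε := by
    rw [neg_nonneg]
    exact Real.logb_nonpos one_lt_two (by linarith) (by linarith)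
  have hl3 : 0 ≤ Real.logb 2 (Fintype.card S) := Real.logb_nonneg one_lt_two hc
  calc ∑ ω, m ω * -Real.logb 2 (if g (Y ω) = X ω then 1 - ε else ε / Fintype.card S)
      ≤ ∑ ω, (m ω * -Real.logb 2 (1 - ε) + (m ω * if g (Y ω) ≠ X ω then 1 else 0) *
          (-Real.logb 2 ε + Real.logb 2 (Fintype.card S))) := by
        refine sum_le_sum fun ω _ => ?_
        have hω := hm.1 ω
        by_cases h : g (Y ω) = X ω
        · simp [h]
        · simp only [h, if_false, ne_eq, not_false_eq_true, if_true, mul_one]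
          rw [Real.logb_div h0.ne' hc0.ne']
          nlinarith [mul_nonneg hω hl1]
    _ = -Real.logb 2 (1 - ε) + pr m (fun ω => g (Y ω) ≠ X ω) *
          (-Real.logb 2 ε + Real.logb 2 (Fintype.card S)) := by
        rw [sum_add_distrib, ← sum_mul, ← sum_mul, hm.2, pr_eq_sum_mul, one_mul]
    _ ≤ _ := by nlinarith [mul_le_mul_of_nonneg_right hg (add_nonneg hl2 hl3)]

end Weights

/-! ### Product weights and the weak law of large numbers -/

section Product

variable {ι X S T : Type*} [Fintype ι]

/-- The product weights: the law of independent draws from `m`, indexed by `ι`. -/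
def pw (m : X → ℝ) (ω : ι → X) : ℝ := ∏ i, m (ω i)

variable {m : X → ℝ}

lemma pw_pos_iff (hm : ∀ x, 0 ≤ m x) (ω : ι → X) : 0 < pw m ω ↔ ∀ i, 0 < m (ω i) := by
  refine ⟨fun h i => (hm _).lt_of_ne fun h0 => h.ne' (prod_eq_zero (mem_univ i) h0.symm),
    fun h => prod_pos fun i _ => h i⟩

variable [Fintype X] [DecidableEq ι]

lemma pw_mem (hm : m ∈ stdSimplex ℝ X) : pw m ∈ stdSimplex ℝ (ι → X) := by
  refine ⟨fun ω => prod_nonneg fun i _ => hm.1 _, ?_⟩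
  have := prod_univ_sum (fun _ : ι => (univ : Finset X)) fun _ x => m x
  simpa [hm.2, pw] using this.symm

lemma push_pw (Y : X → S) : push (pw m) (fun (ω : ι → X) i => Y (ω i)) = pw (push m Y) := by
  classical
  ext y
  have := prod_univ_sum (fun _ : ι => (univ : Finset X)) fun i x => if Y x = y i then m x else 0
  rw [Fintype.piFinset_univ] at this
  simp only [push, pw, pr]
  rw [this]
  refine sum_congr rfl fun ω _ => ?_
  by_cases h : (fun i => Y (ω i)) = y
  · subst h; simp
  · rw [if_neg h]
    obtain ⟨i, hi⟩ := Function.ne_iff.1 h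
    exact (prod_eq_zero (mem_univ i) (if_neg hi)).symm

/-- Resampling the coordinate `i` does not change expectations under a product law. -/
lemma sum_pw_update (hm : ∑ x, m x = 1) (i : ι) (f : (ι → X) → ℝ) :
    ∑ ω, pw m ω * f ω = ∑ ω, pw m ω * ∑ x, m x * f (Function.update ω i x) := by
  have h1 : ∑ ω, pw m ω * f ω = ∑ z : (ι → X) × X, pw m z.1 * m z.2 * f z.1 := by
    rw [Fintype.sum_prod_type]
    refine sum_congr rfl fun ω _ => ?_
    dsimp only
    rw [← sum_mul, ← mul_sum, hm, mul_one]
  have h2 : ∑ ω, pw m ω * ∑ x, m x * f (Function.update ω i x) =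
      ∑ z : (ι → X) × X, pw m z.1 * m z.2 * f (Function.update z.1 i z.2) := by
    rw [Fintype.sum_prod_type]
    refine sum_congr rfl fun ω _ => ?_
    rw [mul_sum]
    exact sum_congr rfl fun x _ => by ring
  rw [h1, h2]
  let σ : (ι → X) × X → (ι → X) × X := fun z => (Function.update z.1 i z.2, z.1 i)
  have hσ : Function.Involutive σ := fun z => by simp [σ]
  rw [← Equiv.sum_comp hσ.toPerm]
  refine sum_congr rfl fun z _ => ?_
  have : pw m (Function.update z.1 i z.2) * m (z.1 i) = pw m z.1 * m z.2 := by
    simp only [pw]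
    rw [← mul_prod_erase univ _ (mem_univ i),
      ← mul_prod_erase univ (fun j => m (z.1 j)) (mem_univ i),
      prod_congr rfl fun j hj => by rw [Function.update_of_ne (ne_of_mem_erase hj)]]
    simp only [Function.update_self]
    ring
  simp [σ, this]

lemma sum_pw_coord (hm : m ∈ stdSimplex ℝ X) (i : ι) (f : X → ℝ) :
    ∑ ω : ι → X, pw m ω * f (ω i) = ∑ x, m x * f x := by
  rw [sum_pw_update hm.2 i]
  simp [← sum_mul, (pw_mem (ι := ι) hm).2]

lemma sum_pw_sum (hm : m ∈ stdSimplex ℝ X) (f : X → ℝ) :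
    ∑ ω : ι → X, pw m ω * ∑ i, f (ω i) = Fintype.card ι * ∑ x, m x * f x := by
  simp only [mul_sum]
  rw [sum_comm]
  simp only [← mul_sum, sum_pw_coord hm]
  simp

lemma ent_pw (hm : m ∈ stdSimplex ℝ X) (Y : X → S) :
    ent (pw m) (fun (ω : ι → X) i => Y (ω i)) = Fintype.card ι * ent m Y := by
  rw [ent, ent, ← sum_pw_sum hm]
  refine sum_congr rfl fun ω _ => ?_
  rcases ((pw_mem (ι := ι) hm).1 ω).eq_or_lt with h0 | h0
  · simp [← h0]
  rw [pw_pos_iff hm.1] at h0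
  rw [push_pw, pw, pw, Real.logb_prod _ _ fun i _ => (push_pos hm.1 Y (h0 i)).ne', sum_neg_distrib]

lemma cent_pw (hm : m ∈ stdSimplex ℝ X) (Y : X → S) (Z : X → T) :
    cent (pw m) (fun (ω : ι → X) i => Y (ω i)) (fun (ω : ι → X) i => Z (ω i)) =
      Fintype.card ι * cent m Y Z := by
  rw [cent, cent, mul_sub, ← ent_pw hm, ← ent_pw hm]
  congr 1
  exact ent_congr fun ω ω' => by simp only [Prod.ext_iff, funext_iff, forall_and]

/-- The variance of a sum of independent centred variables. -/
lemma sum_pw_sq (hm : m ∈ stdSimplex ℝ X) (f : X → ℝ) (hf : ∑ x, m x * f x = 0) :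
    ∑ ω : ι → X, pw m ω * (∑ i, f (ω i)) ^ 2 = Fintype.card ι * ∑ x, m x * f x ^ 2 := by
  have h : ∀ i j : ι, ∑ ω : ι → X, pw m ω * (f (ω i) * f (ω j)) =
      if i = j then ∑ x, m x * f x ^ 2 else 0 := by
    intro i j
    split_ifs with hij
    · subst hij
      simp only [← sq]
      exact sum_pw_coord hm i fun x => f x ^ 2
    · rw [sum_pw_update hm.2 i]
      simp only [Function.update_self, Function.update_of_ne (Ne.symm hij), ← mul_assoc, ← sum_mul]
      simp [hf]
  have e : ∀ ω : ι → X, pw m ω * (∑ i, f (ω i)) ^ 2 =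
      ∑ i, ∑ j, pw m ω * (f (ω i) * f (ω j)) := fun ω => by
    rw [sq, sum_mul_sum, mul_sum]
    exact sum_congr rfl fun i _ => mul_sum _ _ _
  simp only [e]
  rw [sum_comm]
  trans ∑ i : ι, ∑ j : ι, ∑ ω, pw m ω * (f (ω i) * f (ω j))
  · exact sum_congr rfl fun i _ => sum_comm
  · simp [h]

lemma chebyshev_pw (hm : m ∈ stdSimplex ℝ X) (f : X → ℝ) {a : ℝ}
    (ha : 0 < a) :
    pr (pw m) (fun ω : ι → X => Fintype.card ι * (∑ x, m x * f x) + a ≤ ∑ i, f (ω i)) ≤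
      Fintype.card ι * (∑ x, m x * (f x - ∑ x, m x * f x) ^ 2) / a ^ 2 := by
  classical
  set μ := ∑ x, m x * f x
  rw [← sum_pw_sq (ι := ι) hm (fun x => f x - μ) (by simp [mul_sub, ← sum_mul, hm.2, μ]), sum_div]
  refine sum_le_sum fun ω _ => ?_
  have h0 := (pw_mem (ι := ι) hm).1 ω
  split_ifs with h
  · rw [mul_div_assoc]
    refine le_mul_of_one_le_right h0 ?_
    rw [one_le_div (by positivity), sum_sub_distrib]
    simp only [sum_const, card_univ, nsmul_eq_mul]
    exact pow_le_pow_left₀ ha.le (by linarith) 2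
  · positivity

/-- The weak law of large numbers, upper tail. -/
lemma weak_law (hm : m ∈ stdSimplex ℝ X) (f : X → ℝ) {δ η : ℝ} (hδ : 0 < δ) (hη : 0 < η) :
    ∃ N₀ : ℕ, ∀ N : ℕ, N₀ ≤ N →
      pr (pw m) (fun ω : Fin N → X => N * (∑ x, m x * f x + δ) ≤ ∑ i, f (ω i)) ≤ η := by
  set C := ∑ x, m x * (f x - ∑ x, m x * f x) ^ 2 with hC
  obtain ⟨N₀, hN₀⟩ := exists_nat_gt (C / (δ ^ 2 * η))
  refine ⟨N₀ + 1, fun N hN => ?_⟩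
  have hN' : (N₀ : ℝ) + 1 ≤ N := by exact_mod_cast hN
  have hN0 : (0 : ℝ) < N := by have : (0:ℝ) ≤ N₀ := N₀.cast_nonneg; linarith
  have h := chebyshev_pw (ι := Fin N) hm f (a := N * δ) (by positivity)
  simp only [Fintype.card_fin, ← mul_add] at h
  refine h.trans ?_
  rw [div_lt_iff₀ (by positivity)] at hN₀
  rw [← hC, div_le_iff₀ (by positivity)]
  have : C ≤ N * (δ ^ 2 * η) := hN₀.le.trans (by gcongr; linarith)
  calc N * C ≤ N * (N * (δ ^ 2 * η)) := by gcongr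
    _ = η * (N * δ) ^ 2 := by ring

end Product

/-! ### Random binning and the Slepian-Wolf theorem -/

section Binning

variable {Ω S T : Type*} [Fintype Ω] [Fintype S]

lemma uniform_mem {K : ℕ} (hK : 1 ≤ K) :
    (fun _ : Fin K => (K : ℝ)⁻¹) ∈ stdSimplex ℝ (Fin K) := by
  have : (K : ℝ) ≠ 0 := by positivity
  exact ⟨fun _ => by positivity, by simp [this]⟩

/-- Random binning, one shot: with `K` bins and a list of at most `L` candidates for each value of
the side information, some binning is decoded correctly except on the complement of the good set
and with an additional probability `L / K`. -/
lemma exists_binning {m : Ω → ℝ} (hm : m ∈ stdSimplex ℝ Ω) (X : Ω → S) (Y : Ω → T)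
    (Good : S → T → Prop) [∀ x y, Decidable (Good x y)] {L : ℝ}
    (hL : ∀ y, ∑ x, (if Good x y then (1:ℝ) else 0) ≤ L) {K : ℕ} (hK : 1 ≤ K) :
    ∃ (f : S → Fin K) (g : Fin K → T → S),
      pr m (fun ω => g (f (X ω)) (Y ω) ≠ X ω) ≤ pr m (fun ω => ¬ Good (X ω) (Y ω)) + L / K := by
  classical
  have hΩ : Nonempty Ω := by
    by_contra h
    rw [not_nonempty_iff] at h
    simpa using hm.2
  have hS : Nonempty S := hΩ.map X
  let g : (S → Fin K) → Fin K → T → S := fun f j y =>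
    if h : ∃ x, f x = j ∧ Good x y then h.choose else Classical.arbitrary S
  set u : (S → Fin K) → ℝ := pw fun _ : Fin K => (K : ℝ)⁻¹ with hu
  have hum : u ∈ stdSimplex ℝ (S → Fin K) := pw_mem (uniform_mem hK)
  -- the number of wrong candidates in the bin of the source symbol
  let F : (S → Fin K) → Ω → ℝ := fun f ω =>
    ∑ x, if Good x (Y ω) then if x ≠ X ω then if f x = f (X ω) then 1 else 0 else 0 else 0
  have hF0 : ∀ f ω, 0 ≤ F f ω := fun f ω => sum_nonneg fun x _ => by split_ifs <;> simp
  have herr : ∀ f, pr m (fun ω => g f (f (X ω)) (Y ω) ≠ X ω) ≤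
      pr m (fun ω => ¬ Good (X ω) (Y ω)) + ∑ ω, m ω * F f ω := by
    intro f
    rw [pr, pr, ← sum_add_distrib]
    refine sum_le_sum fun ω _ => ?_
    have hω := hm.1 ω
    have hmF := mul_nonneg hω (hF0 f ω)
    split_ifs with h1 h2 h2
    · have hex : ∃ x, f x = f (X ω) ∧ Good x (Y ω) := ⟨X ω, rfl, h2⟩
      have hg : g f (f (X ω)) (Y ω) = hex.choose := dif_pos hex
      rw [hg] at h1
      have : (1:ℝ) ≤ F f ω := by
        have := single_le_sum (f := fun x => if Good x (Y ω) then if x ≠ X ω then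
          if f x = f (X ω) then (1:ℝ) else 0 else 0 else 0)
          (fun x _ => by split_ifs <;> simp) (mem_univ hex.choose)
        simpa only [hex.choose_spec.1, hex.choose_spec.2, h1, if_true, ne_eq,
          not_false_eq_true] using this
      nlinarith
    all_goals linarith
  have hpair : ∀ x x' : S, x ≠ x' → ∑ f, u f * (if f x = f x' then (1:ℝ) else 0) = (K:ℝ)⁻¹ := by
    intro x x' hx
    rw [hu, sum_pw_update (uniform_mem hK).2 x]
    simp only [Function.update_self, Function.update_of_ne hx.symm]
    simp only [mul_ite, mul_one, mul_zero, sum_ite_eq', mem_univ, if_true]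
    rw [← sum_mul, (pw_mem (uniform_mem hK)).2, one_mul]
  have havg : ∑ f, u f * ∑ ω, m ω * F f ω ≤ L / K := by
    calc ∑ f, u f * ∑ ω, m ω * F f ω = ∑ ω, m ω * ∑ f, u f * F f ω := by
          simp only [mul_sum]
          rw [sum_comm]
          exact sum_congr rfl fun ω _ => sum_congr rfl fun f _ => by ring_nf
      _ ≤ ∑ ω, m ω * (L / K) := by
          refine sum_le_sum fun ω _ => mul_le_mul_of_nonneg_left ?_ (hm.1 ω)
          calc ∑ f, u f * F f ω = ∑ x, if Good x (Y ω) then if x ≠ X ω then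
                ∑ f, u f * (if f x = f (X ω) then (1:ℝ) else 0) else 0 else 0 := by
                simp only [F, mul_sum]
                rw [sum_comm]
                refine sum_congr rfl fun x _ => ?_
                split_ifs <;> simp
            _ ≤ ∑ x, (if Good x (Y ω) then (1:ℝ) else 0) * (K:ℝ)⁻¹ := by
                refine sum_le_sum fun x _ => ?_
                split_ifs with h1 h2
                · rw [hpair _ _ h2, one_mul]
                · positivity
                · simp
            _ ≤ L / K := by
                rw [← sum_mul, div_eq_mul_inv]
                exact mul_le_mul_of_nonneg_right (hL _) (by positivity)
      _ = L / K := by rw [← sum_mul, hm.2, one_mul]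
  obtain ⟨f, hf⟩ := exists_le_of_sum_mul_le hum havg
  exact ⟨f, g f, (herr f).trans (by linarith)⟩


lemma sum_prod_kernel_le_one {ι : Type*} [Fintype ι] [DecidableEq ι] (κ : S → T → ℝ)
    (h0 : ∀ x y, 0 ≤ κ x y) (h1 : ∀ y, ∑ x, κ x y ≤ 1) (y : ι → T) :
    ∑ x : ι → S, ∏ i, κ (x i) (y i) ≤ 1 := by
  have := prod_univ_sum (fun _ : ι => (univ : Finset S)) fun i x => κ x (y i)
  rw [Fintype.piFinset_univ] at this
  rw [← this]
  exact prod_le_one (fun i _ => sum_nonneg fun x _ => h0 _ _) fun i _ => h1 _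

lemma exists_two_rpow_neg_le {δ ε : ℝ} (hδ : 0 < δ) (hε : 0 < ε) :
    ∃ N₀ : ℕ, ∀ N : ℕ, N₀ ≤ N → (2:ℝ) ^ (-(N * δ)) ≤ ε := by
  have h1 : (2:ℝ) ^ (-δ) < 1 := Real.rpow_lt_one_of_one_lt_of_neg one_lt_two (by linarith)
  have h := (tendsto_pow_atTop_nhds_zero_of_lt_one (by positivity) h1).eventually (gt_mem_nhds hε)
  obtain ⟨N₀, hN₀⟩ := Filter.eventually_atTop.1 h
  refine ⟨N₀, fun N hN => (le_of_eq ?_).trans (hN₀ N hN).le⟩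
  rw [← Real.rpow_natCast, ← Real.rpow_mul (by norm_num)]
  congr 1; ring

/-- The Slepian-Wolf theorem for a source `X` with side information `Y` at the decoder. -/
lemma slepian_wolf {m : Ω → ℝ} (hm : m ∈ stdSimplex ℝ Ω) (X : Ω → S) (Y : Ω → T) {δ ε : ℝ}
    (hδ : 0 < δ) (hε : 0 < ε) :
    ∃ N₀ : ℕ, ∀ N : ℕ, N₀ ≤ N → ∃ K : ℕ, (K : ℝ) ≤ (2:ℝ) ^ (N * (cent m X Y + δ)) ∧
      ∃ (f : (Fin N → S) → Fin K) (g : Fin K → (Fin N → T) → (Fin N → S)),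
        pr (pw m) (fun ω : Fin N → Ω => g (f fun i => X (ω i)) (fun i => Y (ω i)) ≠
          fun i => X (ω i)) ≤ ε := by
  classical
  set h := cent m X Y with hh
  have hh0 : 0 ≤ h := cent_nonneg hm.1 X Y
  set κ : S → T → ℝ := fun x y => push m (fun ω => (X ω, Y ω)) (x, y) / push m Y y with hκ
  have hκ0 : ∀ x y, 0 ≤ κ x y := fun x y => div_nonneg (push_nonneg hm.1 _ _) (push_nonneg hm.1 _ _)
  have hκ1 : ∀ y, ∑ x, κ x y ≤ 1 := fun y => sum_push_pair_div_le X Y y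
  have hκp : ∀ ω, 0 < m ω → 0 < κ (X ω) (Y ω) := fun ω hω =>
    div_pos (push_pos hm.1 (fun ω => (X ω, Y ω)) hω) (push_pos hm.1 Y hω)
  have hmean : ∑ ω, m ω * -Real.logb 2 (κ (X ω) (Y ω)) = h := by
    rw [hh, cent, ent, ent, ← sum_sub_distrib]
    refine sum_congr rfl fun ω _ => ?_
    rcases (hm.1 ω).eq_or_lt with h0 | h0
    · simp [← h0]
    rw [hκ, Real.logb_div (push_pos hm.1 (fun ω => (X ω, Y ω)) h0).ne' (push_pos hm.1 Y h0).ne']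
    ring
  obtain ⟨N₁, hN₁⟩ := weak_law hm (fun ω => -Real.logb 2 (κ (X ω) (Y ω)))
    (half_pos hδ) (half_pos hε)
  obtain ⟨N₂, hN₂⟩ := exists_two_rpow_neg_le (half_pos hδ) (ε := ε / 4) (by positivity)
  refine ⟨max N₁ N₂, fun N hN => ⟨⌊(2:ℝ) ^ (N * (h + δ))⌋₊, Nat.floor_le (by positivity), ?_⟩⟩
  have hx1 : (1:ℝ) ≤ (2:ℝ) ^ (N * (h + δ)) := Real.one_le_rpow one_le_two (by positivity)
  have hK : 1 ≤ ⌊(2:ℝ) ^ (N * (h + δ))⌋₊ := by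
    rw [Nat.one_le_floor_iff]; exact hx1
  have hK' : (2:ℝ) ^ (N * (h + δ)) / 2 ≤ ⌊(2:ℝ) ^ (N * (h + δ))⌋₊ := by
    have h1 := Nat.lt_floor_add_one ((2:ℝ) ^ (N * (h + δ)))
    have h2 : (1:ℝ) ≤ ⌊(2:ℝ) ^ (N * (h + δ))⌋₊ := by exact_mod_cast hK
    linarith
  obtain ⟨f, g, hfg⟩ := exists_binning (pw_mem (ι := Fin N) hm) (fun ω i => X (ω i))
    (fun ω i => Y (ω i)) (fun x y => (2:ℝ) ^ (-(N * (h + δ / 2))) ≤ ∏ i, κ (x i) (y i))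
    (L := (2:ℝ) ^ (N * (h + δ / 2))) (fun y => by
      have h1 := sum_prod_kernel_le_one κ hκ0 hκ1 y
      have h2 : ∑ x : Fin N → S, (if (2:ℝ) ^ (-(N * (h + δ / 2))) ≤ ∏ i, κ (x i) (y i)
          then (1:ℝ) else 0) * (2:ℝ) ^ (-(N * (h + δ / 2))) ≤ 1 := by
        refine le_trans (sum_le_sum fun x _ => ?_) h1
        split_ifs with h3
        · simpa using h3
        · simpa using prod_nonneg fun i _ => hκ0 _ _
      have h4 : (2:ℝ) ^ (-(N * (h + δ / 2))) * (2:ℝ) ^ (N * (h + δ / 2)) = 1 := by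
        rw [← Real.rpow_add (by norm_num)]; simp
      rw [← sum_mul] at h2
      have h5 := mul_le_mul_of_nonneg_right h2 (by positivity : 0 ≤ (2:ℝ) ^ (N * (h + δ / 2)))
      rwa [mul_assoc, h4, mul_one, one_mul] at h5) hK
  refine ⟨f, g, hfg.trans ?_⟩
  have h1 : pr (pw m) (fun ω : Fin N → Ω => ¬ (2:ℝ) ^ (-(N * (h + δ / 2))) ≤
      ∏ i, κ (X (ω i)) (Y (ω i))) ≤ ε / 2 := by
    refine le_trans (pr_mono (pw_mem hm).1 fun ω hω hlt => ?_) (hN₁ N (le_of_max_le_left hN))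
    rw [pw_pos_iff hm.1] at hω
    rw [hmean, sum_neg_distrib, ← Real.logb_prod _ _ fun i _ => (hκp _ (hω i)).ne']
    rw [not_le] at hlt
    have := Real.logb_lt_logb one_lt_two (prod_pos fun i _ => hκp _ (hω i)) hlt
    rw [Real.logb_rpow (by norm_num) (by norm_num)] at this
    linarith
  have h2 : (2:ℝ) ^ (N * (h + δ / 2)) / ⌊(2:ℝ) ^ (N * (h + δ))⌋₊ ≤ ε / 2 := by
    calc (2:ℝ) ^ (N * (h + δ / 2)) / ⌊(2:ℝ) ^ (N * (h + δ))⌋₊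
        ≤ (2:ℝ) ^ (N * (h + δ / 2)) / ((2:ℝ) ^ (N * (h + δ)) / 2) := by gcongr
      _ = 2 * (2:ℝ) ^ (-(N * (δ / 2))) := by
          rw [div_div_eq_mul_div, mul_comm, mul_div_assoc, ← Real.rpow_sub (by norm_num)]
          congr 2; ring
      _ ≤ 2 * (ε / 4) := by gcongr; exact hN₂ N (le_of_max_le_right hN)
      _ = ε / 2 := by ring
  linarith

end Binning

/-! ### Auxiliary channels and random codebooks -/

section Channel

variable {Ω 𝒰 S T : Type*} [Fintype Ω] [Fintype 𝒰]

/-- The joint law of `(U, ω)` when `ω` is drawn from `m` and `U` is the output of the channel `k`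
with input `A ω`. -/
def joint (m : Ω → ℝ) (A : Ω → S) (k : S → 𝒰 → ℝ) (z : 𝒰 × Ω) : ℝ := m z.2 * k (A z.2) z.1

variable {m : Ω → ℝ} {A : Ω → S} {k : S → 𝒰 → ℝ}

lemma sum_joint_snd (hk : ∀ a, k a ∈ stdSimplex ℝ 𝒰) (f : Ω → ℝ) :
    ∑ z, joint m A k z * f z.2 = ∑ ω, m ω * f ω := by
  rw [Fintype.sum_prod_type_right]
  refine sum_congr rfl fun ω _ => ?_
  simp only [joint]
  rw [← sum_mul, ← mul_sum, (hk _).2, mul_one]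

lemma joint_mem (hm : m ∈ stdSimplex ℝ Ω) (hk : ∀ a, k a ∈ stdSimplex ℝ 𝒰) :
    joint m A k ∈ stdSimplex ℝ (𝒰 × Ω) := by
  refine ⟨fun z => mul_nonneg (hm.1 _) ((hk _).1 _), ?_⟩
  simpa [hm.2] using sum_joint_snd (m := m) (A := A) hk fun _ => 1

lemma push_joint_snd (hk : ∀ a, k a ∈ stdSimplex ℝ 𝒰) (Y : Ω → T) :
    push (joint m A k) (fun z => Y z.2) = push m Y := by
  classical
  ext y
  simp only [push, pr_eq_sum_mul]
  exact sum_joint_snd hk fun ω => if Y ω = y then 1 else 0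

lemma ent_joint_snd (hk : ∀ a, k a ∈ stdSimplex ℝ 𝒰) (Y : Ω → T) :
    ent (joint m A k) (fun z => Y z.2) = ent m Y := by
  rw [ent, push_joint_snd hk]
  exact sum_joint_snd hk fun ω => -Real.logb 2 (push m Y (Y ω))

/-- If `Z` determines the input `A`, then `H(U, Z) = H(Z) + H(U | A)`: this is where the Markov
chain `U - A - Z` enters. -/
lemma ent_joint_pair (hm : m ∈ stdSimplex ℝ Ω) (hk : ∀ a, k a ∈ stdSimplex ℝ 𝒰) (Z : Ω → T)
    (hZ : ∀ ω ω', Z ω = Z ω' → A ω = A ω') :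
    ent (joint m A k) (fun z => (z.1, Z z.2)) =
      ent m Z + ∑ z, joint m A k z * -Real.logb 2 (k (A z.2) z.1) := by
  classical
  rw [← ent_joint_snd (A := A) hk Z, ent, ent, ← sum_add_distrib]
  refine sum_congr rfl fun z _ => ?_
  rcases ((joint_mem (A := A) hm hk).1 z).eq_or_lt with h0 | h0
  · simp [← h0]
  have h1 : push (joint m A k) (fun z => (z.1, Z z.2)) (z.1, Z z.2) =
      push m Z (Z z.2) * k (A z.2) z.1 := by
    simp only [push, pr, sum_mul, Fintype.sum_prod_type_right]
    refine sum_congr rfl fun ω _ => ?_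
    by_cases h : Z ω = Z z.2
    · simp [h, joint, hZ _ _ h]
    · simp [h]
  have hmz : 0 < m z.2 := (hm.1 _).lt_of_ne fun h => by simp [joint, ← h] at h0
  have hkz : 0 < k (A z.2) z.1 := ((hk _).1 _).lt_of_ne fun h => by simp [joint, ← h] at h0
  rw [push_joint_snd hk, h1, Real.logb_mul (push_pos hm.1 Z hmz).ne' hkz.ne']
  ring

end Channel

section Covering

variable {Ω S : Type*} [Fintype Ω]

open scoped Classical in
/-- The conditional expectation `E[F | A = a]`. -/
noncomputable def condE (m : Ω → ℝ) (A : Ω → S) (F : Ω → ℝ) (a : S) : ℝ :=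
  (∑ ω, if A ω = a then m ω * F ω else 0) / push m A a

variable {m : Ω → ℝ}

lemma sum_mul_condE [Fintype S] (hm : ∀ ω, 0 ≤ m ω) (A : Ω → S) (F : S → Ω → ℝ) :
    ∑ ω, m ω * condE m A (F (A ω)) (A ω) = ∑ ω, m ω * F (A ω) ω := by
  classical
  rw [← sum_push_mul A fun a => condE m A (F a) a]
  have : ∀ a, push m A a * condE m A (F a) a = ∑ ω, if A ω = a then m ω * F a ω else 0 := by
    intro a
    by_cases h : push m A a = 0
    · rw [h, zero_mul]
      refine (sum_eq_zero fun ω _ => ?_).symm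
      split_ifs with hω
      · have := le_push hm A ω
        rw [hω, h] at this
        rw [le_antisymm this (hm ω), zero_mul]
      · rfl
    · rw [condE, mul_div_cancel₀ _ h]
  simp only [this]
  rw [sum_comm]
  exact sum_congr rfl fun ω _ => by simp

lemma sum_pw_condE [Fintype S] {ι W : Type*} [Fintype ι] [DecidableEq ι]
    (hm : m ∈ stdSimplex ℝ Ω) (A : Ω → S) (g : (ι → S) → W) (F : W → Ω → ℝ) (i : ι) :
    ∑ ω : ι → Ω, pw m ω * F (g fun j => A (ω j)) (ω i) =
      ∑ ω : ι → Ω, pw m ω * condE m A (F (g fun j => A (ω j))) (A (ω i)) := by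
  have hu : ∀ (ω : ι → Ω) x, (fun j => A (Function.update ω i x j)) =
      Function.update (fun j => A (ω j)) i (A x) := fun ω x => by
    ext j; by_cases h : j = i
    · subst h; simp
    · simp [h]
  rw [sum_pw_update hm.2 i, sum_pw_update hm.2 i
    fun ω => condE m A (F (g fun j => A (ω j))) (A (ω i))]
  refine sum_congr rfl fun ω _ => ?_
  simp only [hu, Function.update_self]
  rw [sum_mul_condE hm.1 A fun a => F (g (Function.update (fun j => A (ω j)) i a))]

/-- Random covering, one shot: `M` codewords drawn from `Q` miss the targets `Tg ω` with small
probability, and at the same time a given weight `s` of the codebook is not much above average. -/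
lemma exists_codebook {𝒳 : Type*} [Fintype 𝒳] (hm : m ∈ stdSimplex ℝ Ω) {Q : 𝒳 → ℝ}
    (hQ : Q ∈ stdSimplex ℝ 𝒳) (Tg : Ω → 𝒳 → Prop) (s : 𝒳 → ℝ) (hs0 : ∀ x, 0 ≤ s x)
    (hs : ∑ x, Q x * s x ≤ 1) {M : ℕ} (hM : 1 ≤ M) {η : ℝ} (hη : 0 < η)
    (h : ∑ ω, m ω * Real.exp (-(M * pr Q (Tg ω))) ≤ η) :
    ∃ C : Fin M → 𝒳, pr m (fun ω => ∀ j, ¬ Tg ω (C j)) ≤ 2 * η ∧ ∑ j, s (C j) ≤ 2 * M := by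
  classical
  have hM0 : (0:ℝ) < M := by exact_mod_cast hM
  have hp : ∀ ω, ∑ C : Fin M → 𝒳, pw Q C * (if ∀ j, ¬ Tg ω (C j) then (1:ℝ) else 0) ≤
      Real.exp (-(M * pr Q (Tg ω))) := by
    intro ω
    have h1 := prod_univ_sum (fun _ : Fin M => (univ : Finset 𝒳))
      fun _ x => if ¬ Tg ω x then Q x else 0
    rw [Fintype.piFinset_univ] at h1
    have h2 : ∑ C : Fin M → 𝒳, pw Q C * (if ∀ j, ¬ Tg ω (C j) then (1:ℝ) else 0) =
        ∏ _j : Fin M, ∑ x, if ¬ Tg ω x then Q x else 0 := by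
      rw [h1]
      refine sum_congr rfl fun C _ => ?_
      split_ifs with hC
      · simp [hC, pw]
      · push Not at hC
        obtain ⟨j, hj⟩ := hC
        rw [mul_zero]
        exact (prod_eq_zero (mem_univ j) (by simp [hj])).symm
    have h3 : ∑ x, (if ¬ Tg ω x then Q x else 0) = 1 - pr Q (Tg ω) := by
      rw [← pr_add_pr_not hQ (Tg ω), add_sub_cancel_left, pr]
      exact sum_congr rfl fun _ _ => by congr
    rw [h2, h3, prod_const, card_univ, Fintype.card_fin, ← mul_neg, Real.exp_nat_mul]
    refine pow_le_pow_left₀ (sub_nonneg.2 (pr_le_one hQ _)) ?_ M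
    linarith [Real.add_one_le_exp (-pr Q (Tg ω))]
  have havg : ∑ C : Fin M → 𝒳, pw Q C *
      (pr m (fun ω => ∀ j, ¬ Tg ω (C j)) / η + (∑ j, s (C j)) / M) ≤ 2 := by
    have h1 : ∑ C : Fin M → 𝒳, pw Q C * pr m (fun ω => ∀ j, ¬ Tg ω (C j)) ≤ η := by
      refine le_trans ?_ h
      simp only [pr_eq_sum_mul (m := m), mul_sum]
      rw [sum_comm]
      refine sum_le_sum fun ω _ => ?_
      refine le_trans (le_of_eq ?_) (mul_le_mul_of_nonneg_left (hp ω) (hm.1 ω))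
      rw [mul_sum]
      exact sum_congr rfl fun C _ => by ring
    have h2 : ∑ C : Fin M → 𝒳, pw Q C * ∑ j, s (C j) ≤ M := by
      rw [sum_pw_sum hQ, Fintype.card_fin]
      exact mul_le_of_le_one_right hM0.le hs
    simp only [mul_add, sum_add_distrib, ← mul_div_assoc, ← sum_div]
    have h3 := (div_le_one hη).2 h1
    have h4 := (div_le_one hM0).2 h2
    linarith
  obtain ⟨C, hC⟩ := exists_le_of_sum_mul_le (pw_mem hQ) havg
  have h1 : 0 ≤ pr m (fun ω => ∀ j, ¬ Tg ω (C j)) / η := div_nonneg (pr_nonneg hm.1 _) hη.le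
  have h2 : 0 ≤ (∑ j, s (C j)) / M := div_nonneg (sum_nonneg fun j _ => hs0 _) hM0.le
  refine ⟨C, ?_, ?_⟩
  · exact (div_le_iff₀ hη).1 (by linarith)
  · exact (div_le_iff₀ hM0).1 (by linarith)

end Covering

/-! ### The covering lemma -/

section Quantizer

variable {Ω 𝒰 S T R : Type*} {m : Ω → ℝ} {A : Ω → S} {k : S → 𝒰 → ℝ}

lemma pw_joint {n : ℕ} (z : Fin n → 𝒰 × Ω) :
    pw (joint m A k) z = pw m (fun i => (z i).2) * ∏ i, k (A (z i).2) (z i).1 := by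
  simp only [pw, joint, prod_mul_distrib]

variable [Fintype Ω] [Fintype 𝒰] [Fintype T]

/-- Convexity of `exp` on the segment from `0` to `-x`, together with `exp (-x) ≤ 1 / x`. -/
lemma exp_neg_mul_le {x t : ℝ} (ht0 : 0 ≤ t) (ht1 : t ≤ 1) (hx : 0 < x) :
    Real.exp (-(x * t)) ≤ 1 - t + 1 / x := by
  have h1 := convexOn_exp.2 (Set.mem_univ (0:ℝ)) (Set.mem_univ (-x)) (sub_nonneg.2 ht1) ht0
    (by ring)
  simp only [smul_eq_mul, mul_zero, zero_add, Real.exp_zero, mul_one] at h1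
  have h2 : Real.exp (-x) ≤ 1 / x := by
    rw [Real.exp_neg, ← one_div]
    exact one_div_le_one_div_of_le hx (by linarith [Real.add_one_le_exp x])
  have h3 : t * Real.exp (-x) ≤ Real.exp (-x) :=
    mul_le_of_le_one_left (Real.exp_pos _).le ht1
  rw [show -(x * t) = t * -x by ring]
  linarith

/-- Covering lemma. For an additive distortion `c`, a codebook with about `I(A; U)` bits per letter
contains, for most source words, a codeword of distortion close to `E c(U, A)`. If `E ρ(U, y) ≤ 1`
for every `y`, with `U` independent of `y`, then the product of `ρ` along a word, summed over the
codebook and averaged over the side information `Y`, can be kept below twice the number of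
codewords. -/
lemma exists_quantizer_codebook (hm : m ∈ stdSimplex ℝ Ω) (hk : ∀ a, k a ∈ stdSimplex ℝ 𝒰)
    (hkp : ∀ a u, 0 < k a u) (c : 𝒰 → S → ℝ) (Y : Ω → T) (ρ : 𝒰 → T → ℝ)
    (hρ0 : ∀ u y, 0 ≤ ρ u y)
    (hρ : ∀ y, ∑ u, push (joint m A k) (fun z => z.1) u * ρ u y ≤ 1)
    {δ η I c₀ : ℝ} (hδ : 0 < δ) (hη : 0 < η)
    (hI : I = ∑ z, joint m A k z *
      Real.logb 2 (k (A z.2) z.1 / push (joint m A k) (fun z => z.1) z.1))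
    (hc₀ : c₀ = ∑ z, joint m A k z * c z.1 (A z.2)) :
    ∃ N₀ : ℕ, ∀ n : ℕ, N₀ ≤ n → ∀ M : ℕ, (2:ℝ) ^ (n * (I + 2 * δ)) ≤ M →
      ∃ C : Fin M → Fin n → 𝒰,
        pr (pw m) (fun ω : Fin n → Ω => ∀ j, ¬ ∑ i, c (C j i) (A (ω i)) < n * (c₀ + δ)) ≤ η ∧
        ∑ y, push (pw m) (fun (ω : Fin n → Ω) i => Y (ω i)) y * ∑ j, ∏ i, ρ (C j i) (y i) ≤
          2 * M := by
  classical
  set J := joint m A k with hJ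
  have hJm : J ∈ stdSimplex ℝ (𝒰 × Ω) := joint_mem hm hk
  set PU := push J (fun z => z.1) with hPU
  have hPUm : PU ∈ stdSimplex ℝ 𝒰 := push_mem hJm _
  obtain ⟨ω₀, hω₀⟩ : ∃ ω, 0 < m ω := by
    by_contra! h
    have := sum_nonpos fun ω (_ : ω ∈ univ) => h ω
    linarith [hm.2]
  have hPUp : ∀ u, 0 < PU u := fun u =>
    push_pos hJm.1 (fun z => z.1) (ω := (u, ω₀)) (mul_pos hω₀ (hkp _ _))
  obtain ⟨N₁, hN₁⟩ := weak_law hJm (fun z => c z.1 (A z.2)) hδ (η := η / 6) (by positivity)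
  obtain ⟨N₂, hN₂⟩ := weak_law hJm (fun z => Real.logb 2 (k (A z.2) z.1 / PU z.1)) hδ
    (η := η / 6) (by positivity)
  obtain ⟨N₃, hN₃⟩ := exists_two_rpow_neg_le hδ (ε := η / 6) (by positivity)
  rw [← hc₀] at hN₁
  rw [← hI] at hN₂
  refine ⟨max N₁ (max N₂ N₃), fun n hn M hM => ?_⟩
  simp only [max_le_iff] at hn
  have hM0 : (0:ℝ) < M := lt_of_lt_of_le (by positivity) hM
  have hM1 : 1 ≤ M := by exact_mod_cast hM0
  let Tg : (Fin n → Ω) → (Fin n → 𝒰) → Prop := fun ω u =>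
    ∑ i, c (u i) (A (ω i)) < n * (c₀ + δ) ∧
    ∑ i, Real.logb 2 (k (A (ω i)) (u i) / PU (u i)) < n * (I + δ)
  let τ : (Fin n → Ω) → ℝ := fun ω => ∑ u, if Tg ω u then ∏ i, k (A (ω i)) (u i) else 0
  have hτ0 : ∀ ω, 0 ≤ τ ω := fun ω => sum_nonneg fun u _ => by
    split_ifs
    · exact prod_nonneg fun i _ => (hkp _ _).le
    · exact le_rfl
  have hksum : ∀ ω : Fin n → Ω, ∑ u : Fin n → 𝒰, ∏ i, k (A (ω i)) (u i) = 1 := fun ω => by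
    have := prod_univ_sum (fun _ : Fin n => (univ : Finset 𝒰)) fun i u => k (A (ω i)) u
    rw [Fintype.piFinset_univ] at this
    simp [← this, (hk _).2]
  have hτ1 : ∀ ω, τ ω ≤ 1 := fun ω => by
    rw [← hksum ω]
    refine sum_le_sum fun u _ => ?_
    split_ifs
    · exact le_rfl
    · exact prod_nonneg fun i _ => (hkp _ _).le
  -- the change of measure from the channel output law to the codeword law
  have hcm : ∀ ω, τ ω * (2:ℝ) ^ (-(n * (I + δ))) ≤ pr (pw PU) (Tg ω) := fun ω => by
    simp only [τ, pr, sum_mul]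
    refine sum_le_sum fun u _ => ?_
    split_ifs with h
    · have h1 := h.2
      rw [← Real.logb_prod _ _ fun i _ => (div_pos (hkp _ _) (hPUp _)).ne',
        Real.logb_lt_iff_lt_rpow one_lt_two
          (prod_pos fun i _ => div_pos (hkp _ _) (hPUp _)), prod_div_distrib,
        div_lt_iff₀ (prod_pos fun i _ => hPUp _)] at h1
      rw [Real.rpow_neg (by norm_num), ← div_eq_mul_inv, div_le_iff₀ (by positivity), mul_comm]
      exact h1.le
    · simp
  have hmiss1 : ∀ ω, Real.exp (-(M * pr (pw PU) (Tg ω))) ≤ 1 - τ ω + (2:ℝ) ^ (-(n * δ)) := by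
    intro ω
    refine le_trans ?_ ((exp_neg_mul_le (hτ0 ω) (hτ1 ω)
      (by positivity : 0 < (2:ℝ) ^ (n * δ))).trans (le_of_eq ?_))
    · rw [Real.exp_le_exp, neg_le_neg_iff]
      calc (2:ℝ) ^ (n * δ) * τ ω
          = (2:ℝ) ^ (n * (I + 2 * δ)) * (τ ω * (2:ℝ) ^ (-(n * (I + δ)))) := by
            rw [mul_left_comm, ← Real.rpow_add (by norm_num), mul_comm]
            congr 2; ring
        _ ≤ M * pr (pw PU) (Tg ω) := by
            refine mul_le_mul hM (hcm ω) (mul_nonneg (hτ0 ω) (by positivity)) hM0.le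
    · rw [Real.rpow_neg (by norm_num), one_div]
  have hτavg : ∑ ω, pw m ω * (1 - τ ω) ≤ η / 6 + η / 6 := by
    have h1 : ∑ ω, pw m ω * (1 - τ ω) =
        pr (pw J) (fun z : Fin n → 𝒰 × Ω => ¬ Tg (fun i => (z i).2) (fun i => (z i).1)) := by
      rw [pr, ← (Equiv.arrowProdEquivProdArrow (Fin n) (fun _ => 𝒰) (fun _ => Ω)).symm.sum_comp,
        Fintype.sum_prod_type_right]
      refine sum_congr rfl fun ω _ => ?_
      rw [← hksum ω]
      simp only [τ]
      rw [← sum_sub_distrib, mul_sum]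
      refine sum_congr rfl fun u _ => ?_
      rw [pw_joint]
      simp only [Equiv.arrowProdEquivProdArrow, Equiv.coe_fn_symm_mk]
      by_cases h : Tg ω u <;> simp [h]
    rw [h1]
    refine le_trans (pr_mono (pw_mem hJm).1 fun z _ hz => ?_)
      ((pr_or_le (pw_mem hJm).1 _ _).trans (add_le_add (hN₁ n hn.1) (hN₂ n hn.2.1)))
    simp only [Tg, not_and_or, not_lt] at hz
    exact hz
  have hmiss : ∑ ω, pw m ω * Real.exp (-(M * pr (pw PU) (Tg ω))) ≤ η / 2 := by
    calc ∑ ω, pw m ω * Real.exp (-(M * pr (pw PU) (Tg ω)))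
        ≤ ∑ ω, pw m ω * (1 - τ ω + (2:ℝ) ^ (-(n * δ))) :=
          sum_le_sum fun ω _ => mul_le_mul_of_nonneg_left (hmiss1 ω) ((pw_mem hm).1 ω)
      _ = ∑ ω, pw m ω * (1 - τ ω) + (2:ℝ) ^ (-(n * δ)) := by
          simp only [mul_add, sum_add_distrib, ← sum_mul, (pw_mem (ι := Fin n) hm).2, one_mul]
      _ ≤ η / 2 := by linarith [hN₃ n hn.2.2]
  set PY := push (pw m) (fun (ω : Fin n → Ω) i => Y (ω i)) with hPY
  have hPYm : PY ∈ stdSimplex ℝ (Fin n → T) := push_mem (pw_mem hm) _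
  obtain ⟨C, hC1, hC2⟩ := exists_codebook (pw_mem (ι := Fin n) hm) (pw_mem (ι := Fin n) hPUm) Tg
    (fun u => ∑ y, PY y * ∏ i, ρ (u i) (y i))
    (fun u => sum_nonneg fun y _ => mul_nonneg (hPYm.1 _) (prod_nonneg fun i _ => hρ0 _ _))
    (by
      simp only [mul_sum]
      rw [sum_comm, ← hPYm.2]
      refine sum_le_sum fun y _ => ?_
      have h1 := sum_prod_kernel_le_one (fun u y => PU u * ρ u y)
        (fun u y => mul_nonneg (hPUp u).le (hρ0 u y)) hρ y
      refine le_trans (le_of_eq ?_) (mul_le_of_le_one_right (hPYm.1 y) h1)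
      rw [mul_sum]
      refine sum_congr rfl fun u _ => ?_
      rw [prod_mul_distrib, pw]
      ring) hM1 (half_pos hη) hmiss
  refine ⟨C, ?_, ?_⟩
  · refine le_trans (pr_mono (pw_mem hm).1 fun ω _ h j => ?_) (hC1.trans (by linarith))
    exact fun hT => h j hT.1
  · refine le_trans (le_of_eq ?_) hC2
    rw [sum_comm]
    exact sum_congr rfl fun y _ => mul_sum _ _ _

end Quantizer

/-! ### Derandomisation of the auxiliary channel -/

section Derandomize

variable {Ω 𝒰 S T R : Type*} [Fintype Ω] {m : Ω → ℝ} {A : Ω → S} {k : S → 𝒰 → ℝ}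

/-- The chain rule for a function `V` of `A`: `H(A | V, Y) = H(A | Y) - H(V | Y)`. -/
lemma cent_of_function {W : Type*} (A : Ω → S) (v : S → W) (Y : Ω → T) :
    cent m A (fun ω => (v (A ω), Y ω)) = cent m A Y - cent m (fun ω => v (A ω)) Y := by
  rw [cent, cent, cent, ent_congr (X := fun ω => (A ω, (v (A ω), Y ω))) (Y := fun ω => (A ω, Y ω))]
  · ring
  · intro ω ω'
    simp only [Prod.ext_iff]
    exact ⟨fun h => ⟨h.1, h.2.2⟩, fun h => ⟨h.1, by rw [h.1], h.2⟩⟩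

variable [Fintype 𝒰] [Fintype S] [Fintype T] [Fintype R]

set_option maxHeartbeats 1000000 in
/-- Derandomisation: over long blocks, a deterministic function of the source does as well as the
random channel `k`. It maps a source word to a codeword of cost close to the mean (or to any
codeword if there is none), where the cost collects the two cross entropies that bound `H(V | E)`
and `H(A | V, B)`. -/
lemma exists_quantizer (hm : m ∈ stdSimplex ℝ Ω) (hk : ∀ a, k a ∈ stdSimplex ℝ 𝒰)
    (hkp : ∀ a u, 0 < k a u) (B : Ω → T) (E : Ω → R) {ε : ℝ} (hε : 0 < ε) :
    ∃ n : ℕ, 1 ≤ n ∧ ∃ M : ℕ, ∃ v : (Fin n → S) → Fin M,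
      n * (cent (joint m A k) (fun z => A z.2) (fun z => (z.1, E z.2)) -
        cent (joint m A k) (fun z => A z.2) (fun z => (z.1, B z.2)) - ε) ≤
      cent (pw m) (fun (ω : Fin n → Ω) i => A (ω i))
          (fun ω => (v fun i => A (ω i), fun i => E (ω i))) -
        cent (pw m) (fun (ω : Fin n → Ω) i => A (ω i))
          (fun ω => (v fun i => A (ω i), fun i => B (ω i))) := by
  classical
  set J := joint m A k with hJ
  have hJm : J ∈ stdSimplex ℝ (𝒰 × Ω) := joint_mem hm hk
  have hJp : ∀ u ω, 0 < m ω → 0 < J (u, ω) := fun u ω hω => mul_pos hω (hkp _ _)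
  -- `5 δ` is lost: `2 δ` in the mean cost, `2 δ` in the rate of the codebook, and `δ` for the two
  -- bits that rounding and normalising the codebook cost
  obtain ⟨δ, hδ, hδε⟩ : ∃ δ : ℝ, 0 < δ ∧ 6 * δ ≤ ε := ⟨ε / 6, by positivity, by linarith⟩
  set U : 𝒰 × Ω → 𝒰 := fun z => z.1 with hU
  set UE : 𝒰 × Ω → 𝒰 × R := fun z => (z.1, E z.2) with hUE
  set AUB : 𝒰 × Ω → S × (𝒰 × T) := fun z => (A z.2, (z.1, B z.2)) with hAUB
  set UB : 𝒰 × Ω → 𝒰 × T := fun z => (z.1, B z.2) with hUB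
  -- the two reference kernels, `P(u | e) / P(u)` and `P(a | u, b)`
  set ρ : 𝒰 → R → ℝ := fun u e => push J UE (u, e) / push m E e / push J U u with hρ
  set κ : S → 𝒰 × T → ℝ := fun a ub => push J AUB (a, ub) / push J UB ub with hκ
  have hρ0 : ∀ u e, 0 ≤ ρ u e := fun u e => div_nonneg (div_nonneg (push_nonneg hJm.1 _ _)
    (push_nonneg hm.1 _ _)) (push_nonneg hJm.1 _ _)
  have hκ0 : ∀ a ub, 0 ≤ κ a ub := fun a ub => div_nonneg (push_nonneg hJm.1 _ _)
    (push_nonneg hJm.1 _ _)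
  have hρp : ∀ u ω, 0 < m ω → 0 < ρ u (E ω) := fun u ω hω => by
    have h1 := push_pos hJm.1 UE (hJp u ω hω)
    have h2 := push_pos hJm.1 U (hJp u ω hω)
    have h3 := push_pos hm.1 E hω
    exact div_pos (div_pos h1 h3) h2
  have hκp : ∀ u ω, 0 < m ω → 0 < κ (A ω) (u, B ω) := fun u ω hω =>
    div_pos (push_pos hJm.1 AUB (hJp u ω hω)) (push_pos hJm.1 UB (hJp u ω hω))
  have hρ1 : ∀ e, ∑ u, push J U u * ρ u e ≤ 1 := fun e => by
    refine le_trans (sum_le_sum fun u _ => ?_) (sum_push_pair_div_le (m := J) U (fun z => E z.2) e)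
    rw [push_joint_snd hk]
    rcases (push_nonneg hJm.1 U u).eq_or_lt with h0 | h0
    · rw [← h0, zero_mul]
      exact div_nonneg (push_nonneg hJm.1 _ _) (push_nonneg hm.1 _ _)
    · exact (mul_div_cancel₀ _ h0.ne').le
  have hκ1 : ∀ ub, ∑ a, κ a ub ≤ 1 := fun ub => sum_push_pair_div_le (fun z => A z.2) UB ub
  -- the cost per letter, and its conditional expectation given the source letter
  set F : 𝒰 → Ω → ℝ := fun u ω => -Real.logb 2 (ρ u (E ω)) + -Real.logb 2 (κ (A ω) (u, B ω))
    with hF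
  set c : 𝒰 → S → ℝ := fun u a => condE m A (F u) a with hc
  set c₀ := ∑ z, J z * c z.1 (A z.2) with hc₀
  set I := ∑ z, J z * Real.logb 2 (k (A z.2) z.1 / push J U z.1) with hI
  have hsupp : ∀ z, J z ≠ 0 → 0 < m z.2 := fun z hz => (hm.1 _).lt_of_ne fun h => hz (by
    rw [hJ, joint, ← h, zero_mul])
  have hc₀' : c₀ = ∑ z, J z * F z.1 z.2 := by
    have h := fun u => sum_mul_condE hm.1 A fun a ω => k a u * F u ω
    have h2 : ∀ u a, condE m A (fun ω => k a u * F u ω) a = k a u * c u a := fun u a => by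
      rw [hc]
      simp only [condE]
      rw [← mul_div_assoc, mul_sum]
      congr 1
      refine sum_congr rfl fun ω _ => ?_
      split_ifs <;> ring
    rw [hc₀, Fintype.sum_prod_type, Fintype.sum_prod_type]
    refine sum_congr rfl fun u _ => ?_
    have := h u
    simp only [h2] at this
    simpa only [hJ, joint, mul_assoc] using this
  have hsum : I + c₀ = ent J UE - ent m E + ent J AUB - ent J UB -
      ∑ z, J z * -Real.logb 2 (k (A z.2) z.1) := by
    rw [hI, hc₀', ← ent_joint_snd (A := A) hk E, ent, ent, ent, ent]
    simp only [← sum_add_distrib, ← sum_sub_distrib]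
    refine sum_congr rfl fun z _ => ?_
    by_cases hz : J z = 0
    · rw [← hJ, hz]; ring
    have hmz := hsupp z hz
    have hJz := hJp z.1 z.2 hmz
    have h1 := (push_pos hJm.1 UE hJz).ne'
    have h2 := (push_pos hJm.1 U hJz).ne'
    have h3 := (push_pos hm.1 E hmz).ne'
    have h4 := (push_pos hJm.1 AUB hJz).ne'
    have h5 := (push_pos hJm.1 UB hJz).ne'
    rw [push_joint_snd hk, ← hJ]
    simp only [hF, hρ, hκ]
    rw [Real.logb_div (hkp _ _).ne' h2, Real.logb_div (div_ne_zero h1 h3) h2,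
      Real.logb_div h1 h3, Real.logb_div h4 h5]
    ring
  have hAE := ent_joint_pair (A := A) hm hk (fun ω => (A ω, E ω)) fun ω ω' h => (Prod.ext_iff.1 h).1
  have hΔ : cent J (fun z => A z.2) UE - cent J (fun z => A z.2) UB = cent m A E - I - c₀ := by
    have h1 : ent J (fun z => (A z.2, UE z)) = ent J (fun z => (z.1, (A z.2, E z.2))) :=
      ent_congr fun z z' => by simp only [hUE, Prod.ext_iff]; tauto
    have h2 : ent J (fun z => (A z.2, UB z)) = ent J AUB := rfl
    rw [cent, cent, cent, h1, h2, hAE]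
    linarith
  have hI0 : 0 ≤ I := by
    have h1 := cent_le_cross_one hJm U (fun z => A z.2) (fun u _ => push J U u)
      (fun u _ => push_nonneg hJm.1 _ _) (fun z hz => push_pos hJm.1 U hz)
      (fun _ => (push_mem hJm U).2.le)
    have h2 : ent J (fun z => (U z, A z.2)) = _ := ent_joint_pair (A := A) hm hk A fun _ _ h => h
    rw [cent, h2, ent_joint_snd hk] at h1
    have h3 : I = ∑ z, J z * -Real.logb 2 (push J U z.1) -
        ∑ z, J z * -Real.logb 2 (k (A z.2) z.1) := by
      rw [hI, ← sum_sub_distrib]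
      refine sum_congr rfl fun z _ => ?_
      by_cases hz : J z = 0
      · simp [hz]
      rw [Real.logb_div (hkp _ _).ne' (push_pos hJm.1 U (hJp z.1 z.2 (hsupp z hz))).ne']
      ring
    rw [h3]
    linarith
  obtain ⟨D, hD0, hD⟩ : ∃ D : ℝ, 0 < D ∧ ∀ u a, c u a ≤ c₀ + δ + D := by
    refine ⟨∑ u, ∑ a, |c u a| + |c₀| + 1, by positivity, fun u a => ?_⟩
    have h1 : |c u a| ≤ ∑ u, ∑ a, |c u a| :=
      (single_le_sum (f := fun a => |c u a|) (fun _ _ => abs_nonneg _) (mem_univ a)).trans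
        (single_le_sum (f := fun u => ∑ a, |c u a|)
          (fun _ _ => sum_nonneg fun _ _ => abs_nonneg _) (mem_univ u))
    linarith [le_abs_self (c u a), neg_abs_le c₀]
  obtain ⟨N₀, hN₀⟩ := exists_quantizer_codebook hm hk hkp c E ρ hρ0 hρ1 hδ
    (η := δ / D) (by positivity) hI hc₀
  obtain ⟨N₁, hN₁⟩ := exists_nat_gt (2 / δ)
  set n := max (max N₀ N₁) 1 with hn
  have hn1 : 1 ≤ n := le_max_right _ _
  have hn2 : 2 ≤ n * δ := by
    rw [div_lt_iff₀ hδ] at hN₁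
    have : (N₁ : ℝ) ≤ n := by
      exact_mod_cast (le_max_right N₀ N₁).trans (le_max_left _ _)
    nlinarith
  set M := ⌈(2:ℝ) ^ (n * (I + 2 * δ))⌉₊ with hM
  have hMle : (M:ℝ) ≤ 2 * (2:ℝ) ^ (n * (I + 2 * δ)) := by
    have h1 := (Nat.ceil_lt_add_one (by positivity : 0 ≤ (2:ℝ) ^ (n * (I + 2 * δ)))).le
    have h2 : (1:ℝ) ≤ (2:ℝ) ^ (n * (I + 2 * δ)) := Real.one_le_rpow one_le_two (by positivity)
    rw [← hM] at h1
    linarith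
  have hM0 : 0 < M := Nat.ceil_pos.2 (by positivity)
  have hM0' : (0:ℝ) < M := by exact_mod_cast hM0
  obtain ⟨C, hC1, hC2⟩ := hN₀ n ((le_max_left _ _).trans (le_max_left _ _)) M (Nat.le_ceil _)
  let v : (Fin n → S) → Fin M := fun a =>
    if h : ∃ j, ∑ i, c (C j i) (a i) < n * (c₀ + δ) then h.choose else ⟨0, hM0⟩
  refine ⟨n, hn1, M, v, ?_⟩
  have hpm := pw_mem (ι := Fin n) hm
  -- the expected cost of the chosen codeword
  have hcost : ∑ ω : Fin n → Ω, pw m ω *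
      ∑ i, c (C (v fun i => A (ω i)) i) (A (ω i)) ≤ n * (c₀ + 2 * δ) := by
    have h1 : ∀ ω : Fin n → Ω, ∑ i, c (C (v fun i => A (ω i)) i) (A (ω i)) ≤ n * (c₀ + δ) +
        (n * D) * if ∀ j, ¬ ∑ i, c (C j i) (A (ω i)) < n * (c₀ + δ) then 1 else 0 := by
      intro ω
      split_ifs with h
      · refine (sum_le_sum fun i _ => hD _ _).trans (le_of_eq ?_)
        simp; ring
      · push Not at h
        have hv : v (fun i => A (ω i)) = h.choose := dif_pos h
        rw [hv, mul_zero, add_zero]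
        exact h.choose_spec.le
    refine (sum_le_sum fun ω _ => mul_le_mul_of_nonneg_left (h1 ω) (hpm.1 ω)).trans ?_
    simp only [mul_add, sum_add_distrib, ← sum_mul, hpm.2, one_mul]
    rw [pr_eq_sum_mul] at hC1
    have h2 : ∑ ω : Fin n → Ω, pw m ω * (n * D * if ∀ j, ¬ ∑ i, c (C j i) (A (ω i)) <
        n * (c₀ + δ) then 1 else 0) ≤ n * δ := by
      calc _ = n * D * ∑ ω : Fin n → Ω, pw m ω * (if ∀ j, ¬ ∑ i, c (C j i) (A (ω i)) <
            n * (c₀ + δ) then (1:ℝ) else 0) := by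
            rw [mul_sum]; exact sum_congr rfl fun ω _ => by ring
        _ ≤ n * D * (δ / D) := by gcongr
        _ = n * δ := by field_simp
    simp only [mul_add] at h2
    linarith
  have hVE : cent (pw m) (fun ω : Fin n → Ω => v fun i => A (ω i)) (fun ω i => E (ω i)) ≤
      ∑ ω : Fin n → Ω, pw m ω * ∑ i, -Real.logb 2 (ρ (C (v fun i => A (ω i)) i) (E (ω i))) +
        (n * (I + 2 * δ) + 2) := by
    have h1 := cent_le_cross hpm (fun ω : Fin n → Ω => v fun i => A (ω i)) (fun ω i => E (ω i))
      (fun j e => ∏ i, ρ (C j i) (e i)) (fun j e => prod_nonneg fun i _ => hρ0 _ _)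
      (fun ω hω => prod_pos fun i _ => hρp _ _ ((pw_pos_iff hm.1 ω).1 hω i))
      (by positivity : (0:ℝ) < 2 * M) hC2
    refine h1.trans (add_le_add (le_of_eq ?_) ?_)
    · refine sum_congr rfl fun ω _ => ?_
      rcases (hpm.1 ω).eq_or_lt with h0 | h0
      · simp [← h0]
      rw [Real.logb_prod _ _ fun i _ => (hρp _ _ ((pw_pos_iff hm.1 ω).1 h0 i)).ne',
        sum_neg_distrib]
    · rw [Real.logb_le_iff_le_rpow one_lt_two (by positivity), Real.rpow_add (by norm_num)]
      norm_num
      linarith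
  have hAB : cent (pw m) (fun (ω : Fin n → Ω) i => A (ω i))
      (fun ω => (v fun i => A (ω i), fun i => B (ω i))) ≤
      ∑ ω : Fin n → Ω, pw m ω *
        ∑ i, -Real.logb 2 (κ (A (ω i)) (C (v fun i => A (ω i)) i, B (ω i))) := by
    have h1 := cent_le_cross_one hpm (fun (ω : Fin n → Ω) i => A (ω i))
      (fun ω => (v fun i => A (ω i), fun i => B (ω i)))
      (fun a jb => ∏ i, κ (a i) (C jb.1 i, jb.2 i)) (fun a jb => prod_nonneg fun i _ => hκ0 _ _)
      (fun ω hω => prod_pos fun i _ => hκp _ _ ((pw_pos_iff hm.1 ω).1 hω i))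
      (fun jb => sum_prod_kernel_le_one κ hκ0 hκ1 fun i => (C jb.1 i, jb.2 i))
    refine h1.trans (le_of_eq ?_)
    refine sum_congr rfl fun ω _ => ?_
    rcases (hpm.1 ω).eq_or_lt with h0 | h0
    · simp [← h0]
    rw [Real.logb_prod _ _ fun i _ => (hκp _ _ ((pw_pos_iff hm.1 ω).1 h0 i)).ne',
      sum_neg_distrib]
  have hFc : ∑ ω : Fin n → Ω, pw m ω *
        ∑ i, -Real.logb 2 (ρ (C (v fun i => A (ω i)) i) (E (ω i))) +
      ∑ ω : Fin n → Ω, pw m ω *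
        ∑ i, -Real.logb 2 (κ (A (ω i)) (C (v fun i => A (ω i)) i, B (ω i))) =
      ∑ ω : Fin n → Ω, pw m ω * ∑ i, c (C (v fun i => A (ω i)) i) (A (ω i)) := by
    simp only [← sum_add_distrib, ← mul_add]
    simp only [mul_sum]
    rw [sum_comm, sum_comm (s := (univ : Finset (Fin n → Ω)))]
    exact sum_congr rfl fun i _ => sum_pw_condE hm A (fun a => C (v a) i) F i
  have hAE' := cent_pw (ι := Fin n) hm A E
  rw [Fintype.card_fin] at hAE'
  rw [cent_of_function (fun (ω : Fin n → Ω) i => A (ω i)) v (fun ω i => E (ω i)), hAE', hΔ]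
  nlinarith

end Derandomize

/-! ### Coding with an auxiliary channel -/

section Coding

variable {Ω 𝒰 S T R W : Type*}

variable [Fintype Ω] {m : Ω → ℝ}

lemma push_equiv (e : Ω ≃ S) (x : S) : push m e x = m (e.symm x) := by
  classical
  simp [push, pr, ← Equiv.eq_symm_apply]

/-- Blocks of blocks: `N` independent words of length `n` are one word of length `N * n`. -/
def blockEquiv (N n : ℕ) (X : Type*) : (Fin (N * n) → X) ≃ (Fin N → Fin n → X) :=
  (Equiv.arrowCongr finProdFinEquiv.symm (Equiv.refl X)).trans (Equiv.curry (Fin N) (Fin n) X)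

lemma blockEquiv_apply {X : Type*} (N n : ℕ) (ω : Fin (N * n) → X) (i : Fin N) (j : Fin n) :
    blockEquiv N n X ω i j = ω (finProdFinEquiv (i, j)) := rfl

lemma push_blockEquiv (N n : ℕ) :
    push (pw m) (blockEquiv N n Ω) = pw (pw m) := by
  ext ω
  rw [push_equiv]
  obtain ⟨ω, rfl⟩ := (blockEquiv N n Ω).surjective ω
  rw [Equiv.symm_apply_apply]
  simp only [pw, blockEquiv_apply]
  rw [← finProdFinEquiv.prod_comp, Fintype.prod_prod_type]

variable [Fintype S] [Fintype R] [Fintype W]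

/-- Coding with a deterministic auxiliary variable `V = v(A)`: bin the words of `V`, then bin the
source words given `V` and `B`. The second bin index is charged to the eavesdropper in full, the
first one only through `H(V | E)`. -/
lemma exists_code_of_function (hm : m ∈ stdSimplex ℝ Ω) (A : Ω → S) (B : Ω → T) (E : Ω → R)
    (v : S → W) {δ ε : ℝ} (hδ : 0 < δ) (hε : 0 < ε) :
    ∃ N : ℕ, 1 ≤ N ∧ ∃ K : ℕ, (K : ℝ) ≤ (2:ℝ) ^ (N * (cent m A B + δ)) ∧
      ∃ (f : (Fin N → S) → Fin K) (g : Fin K → (Fin N → T) → (Fin N → S)),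
        pr (pw m) (fun ω : Fin N → Ω => g (f fun i => A (ω i)) (fun i => B (ω i)) ≠
          fun i => A (ω i)) ≤ ε ∧
        N * (cent m A (fun ω => (v (A ω), E ω)) - cent m A (fun ω => (v (A ω), B ω)) - δ) ≤
          cent (pw m) (fun (ω : Fin N → Ω) i => A (ω i))
            (fun ω => (f fun i => A (ω i), fun i => E (ω i))) := by
  obtain ⟨N₁, h₁⟩ := slepian_wolf hm (fun ω => v (A ω)) B (half_pos hδ) (half_pos hε)
  obtain ⟨N₂, h₂⟩ := slepian_wolf hm A (fun ω => (v (A ω), B ω)) (half_pos hδ) (half_pos hε)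
  obtain ⟨N, hN1, hN2, hN3⟩ : ∃ N, N₁ ≤ N ∧ N₂ ≤ N ∧ 1 ≤ N :=
    ⟨max N₁ (max N₂ 1), by simp, by simp, by simp⟩
  obtain ⟨K₁, hK₁, f₁, g₁, he₁⟩ := h₁ N hN1
  obtain ⟨K₂, hK₂, f₂, g₂, he₂⟩ := h₂ N hN2
  have hpm := pw_mem (ι := Fin N) hm
  set AN : (Fin N → Ω) → Fin N → S := fun ω i => A (ω i) with hAN
  set EN : (Fin N → Ω) → Fin N → R := fun ω i => E (ω i) with hEN
  let F₁ : (Fin N → S) → Fin K₁ := fun a => f₁ fun i => v (a i)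
  let f : (Fin N → S) → Fin (K₁ * K₂) := fun a => finProdFinEquiv (F₁ a, f₂ a)
  let g : Fin (K₁ * K₂) → (Fin N → T) → (Fin N → S) := fun j b =>
    g₂ (finProdFinEquiv.symm j).2 fun i => (g₁ (finProdFinEquiv.symm j).1 b i, b i)
  refine ⟨N, hN3, K₁ * K₂, ?_, f, g, ?_, ?_⟩
  · push_cast
    refine (mul_le_mul hK₁ hK₂ (by positivity) (by positivity)).trans (le_of_eq ?_)
    rw [← Real.rpow_add (by norm_num), cent_of_function A v B]
    congr 1; ring
  · refine (pr_mono hpm.1 fun ω _ h => ?_).trans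
      ((pr_or_le hpm.1 _ _).trans ((add_le_add he₁ he₂).trans (by linarith)))
    by_contra! hc
    refine h ?_
    simp only [g, f, F₁, Equiv.symm_apply_apply]
    rw [hc.1]
    exact hc.2
  · rw [cent_of_function AN f EN]
    have hcA := cent_pw (ι := Fin N) hm A E
    rw [Fintype.card_fin] at hcA
    -- split the index into its two parts
    have h1 : cent (pw m) (fun ω => f (AN ω)) EN =
        cent (pw m) (fun ω => f₂ (AN ω)) (fun ω => (F₁ (AN ω), EN ω)) +
          cent (pw m) (fun ω => F₁ (AN ω)) EN := by
      rw [cent, cent, cent, ent_congr (X := fun ω => (f (AN ω), EN ω))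
        (Y := fun ω => (f₂ (AN ω), (F₁ (AN ω), EN ω)))]
      · ring
      · intro ω ω'
        simp only [f, Prod.ext_iff, finProdFinEquiv.injective.eq_iff]
        tauto
    have h2 : cent (pw m) (fun ω => F₁ (AN ω)) EN ≤ N * cent m (fun ω => v (A ω)) E := by
      have h3 := cent_pw (ι := Fin N) hm (fun ω => v (A ω)) E
      rw [Fintype.card_fin] at h3
      rw [← h3]
      refine sub_le_sub_right (ent_le_ent hpm.1 fun ω ω' h => ?_) _
      simp only [Prod.ext_iff] at h ⊢
      exact ⟨congrArg f₁ h.1, h.2⟩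
    have h4 : cent (pw m) (fun ω => f₂ (AN ω)) (fun ω => (F₁ (AN ω), EN ω)) ≤
        N * (cent m A (fun ω => (v (A ω), B ω)) + δ / 2) := by
      refine (cent_le_logb_card hpm _ _).trans ?_
      rw [Fintype.card_fin]
      have hK : 0 < K₂ := by
        by_contra h
        have hK0 : K₂ = 0 := by omega
        subst hK0
        have : IsEmpty (Fin N → Ω) := ⟨fun ω => (f₂ (AN ω)).elim0⟩
        simpa using hpm.2
      rwa [Real.logb_le_iff_le_rpow one_lt_two (by exact_mod_cast hK)]
    rw [hcA, cent_of_function A v E, h1]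
    have : 0 ≤ (N : ℝ) * (δ / 2) := by positivity
    linarith

variable [Fintype T] [Fintype 𝒰] {A : Ω → S} {k : S → 𝒰 → ℝ}

/-- Coding with an auxiliary channel of full support: the channel is made deterministic on words of
length `n`, and these words become the letters of the source that is coded. -/
lemma exists_code_of_channel (hm : m ∈ stdSimplex ℝ Ω) (hk : ∀ a, k a ∈ stdSimplex ℝ 𝒰)
    (hkp : ∀ a u, 0 < k a u) (B : Ω → T) (E : Ω → R) {ε : ℝ} (hε : 0 < ε) :
    ∃ L : ℕ, 1 ≤ L ∧ ∃ K : ℕ, (K : ℝ) ≤ (2:ℝ) ^ (L * (cent m A B + ε)) ∧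
      ∃ (f : (Fin L → S) → Fin K) (g : Fin K → (Fin L → T) → (Fin L → S)),
        pr (pw m) (fun ω : Fin L → Ω => g (f fun i => A (ω i)) (fun i => B (ω i)) ≠
          fun i => A (ω i)) ≤ ε ∧
        L * (cent (joint m A k) (fun z => A z.2) (fun z => (z.1, E z.2)) -
            cent (joint m A k) (fun z => A z.2) (fun z => (z.1, B z.2)) - ε) ≤
          cent (pw m) (fun (ω : Fin L → Ω) i => A (ω i))
            (fun ω => (f fun i => A (ω i), fun i => E (ω i))) := by
  obtain ⟨n, hn, M, v, hv⟩ := exists_quantizer hm hk hkp B E (half_pos hε)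
  have hpm := pw_mem (ι := Fin n) hm
  obtain ⟨N, hN, K, hK, f, g, herr, heq⟩ := exists_code_of_function hpm
    (fun (ω : Fin n → Ω) i => A (ω i)) (fun ω i => B (ω i)) (fun ω i => E (ω i)) v
    (half_pos hε) hε
  have hn' : (1:ℝ) ≤ n := by exact_mod_cast hn
  have hN0 : (0:ℝ) ≤ N := N.cast_nonneg
  have hnε : ε / 2 ≤ n * (ε / 2) := le_mul_of_one_le_left (half_pos hε).le hn'
  refine ⟨N * n, Nat.one_le_iff_ne_zero.2 (Nat.mul_ne_zero (by omega) (by omega)), K, ?_,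
    fun a => f (blockEquiv N n S a),
    fun j b => (blockEquiv N n S).symm (g j (blockEquiv N n T b)), ?_, ?_⟩
  · refine hK.trans (Real.rpow_le_rpow_of_exponent_le one_le_two ?_)
    rw [cent_pw hm, Fintype.card_fin]
    push_cast
    rw [mul_assoc]
    refine mul_le_mul_of_nonneg_left ?_ hN0
    rw [mul_add]
    refine add_le_add_right (hnε.trans ?_) _
    exact mul_le_mul_of_nonneg_left (half_le_self hε.le) (by positivity)
  · rw [← push_blockEquiv, pr_push] at herr
    refine le_trans (pr_mono (pw_mem hm).1 fun ω _ h => ?_) herr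
    exact fun h' => h ((Equiv.symm_apply_eq _).2 h')
  · rw [← push_blockEquiv, cent_push] at heq
    have h1 : cent (pw m) (fun (ω : Fin (N * n) → Ω) i => A (ω i))
          (fun ω => (f (blockEquiv N n S fun i => A (ω i)), fun i => E (ω i))) =
        cent (pw m) (fun ω i j => A (blockEquiv N n Ω ω i j)) (fun ω =>
          (f fun i j => A (blockEquiv N n Ω ω i j), fun i j => E (blockEquiv N n Ω ω i j))) := by
      have hA : ∀ ω : Fin (N * n) → Ω, (fun i j => A (blockEquiv N n Ω ω i j)) =
        blockEquiv N n S fun i => A (ω i) := fun ω => rfl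
      have hE : ∀ ω : Fin (N * n) → Ω, (fun i j => E (blockEquiv N n Ω ω i j)) =
        blockEquiv N n R fun i => E (ω i) := fun ω => rfl
      simp only [hA, hE]
      rw [cent, cent]
      congr 1 <;> refine ent_congr fun ω ω' => ?_ <;>
        simp only [Prod.ext_iff, Equiv.apply_eq_iff_eq]
      rw [hA ω, hA ω', Equiv.apply_eq_iff_eq]
    rw [h1]
    refine le_trans ?_ heq
    push_cast
    rw [mul_assoc]
    refine mul_le_mul_of_nonneg_left ?_ hN0
    refine le_trans (le_of_eq ?_) (sub_le_sub hv hnε)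
    ring

end Coding

/-! ### The optimal auxiliary channel -/

section Region

variable {Ω 𝒰 S T R : Type*} [Fintype Ω]

/-- The equivocation rate `H(A | U, E) - H(A | U, B)` of the auxiliary channel `k`, which equals
`I(A; B | U) - I(A; E | U)`. -/
noncomputable def channelValue [Fintype 𝒰] (m : Ω → ℝ) (A : Ω → S) (B : Ω → T) (E : Ω → R)
    (k : S → 𝒰 → ℝ) : ℝ :=
  cent (joint m A k) (fun z => A z.2) (fun z => (z.1, E z.2)) -
    cent (joint m A k) (fun z => A z.2) (fun z => (z.1, B z.2))

open scoped Classical in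
/-- The weight of `B = b` when each `ω` is reweighted by `w (A ω)`. -/
noncomputable def tilt (m : Ω → ℝ) (A : Ω → S) (B : Ω → T) (w : S → ℝ) (b : T) : ℝ :=
  ∑ ω, if B ω = b then m ω * w (A ω) else 0

/-- The contribution of one letter of `U`, with channel column `w = k(u | ·)`, to
`H(U, B) - H(U, E)`. -/
noncomputable def columnValue [Fintype T] [Fintype R] (m : Ω → ℝ) (A : Ω → S) (B : Ω → T)
    (E : Ω → R) (w : S → ℝ) : ℝ :=
  (∑ b, tilt m A B w b * -Real.logb 2 (tilt m A B w b)) -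
    ∑ e, tilt m A E w e * -Real.logb 2 (tilt m A E w e)

variable {m : Ω → ℝ} {A : Ω → S} {B : Ω → T} {E : Ω → R}

/-- The Markov chain turns the value into `H(U, B) - H(U, E)` plus a constant. -/
lemma channelValue_eq_ent [Fintype 𝒰] (hm : m ∈ stdSimplex ℝ Ω) {k : S → 𝒰 → ℝ}
    (hk : ∀ a, k a ∈ stdSimplex ℝ 𝒰) :
    channelValue m A B E k =
      ent (joint m A k) (fun z => (z.1, B z.2)) - ent (joint m A k) (fun z => (z.1, E z.2)) +
        (ent m (fun ω => (A ω, E ω)) - ent m (fun ω => (A ω, B ω))) := by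
  have h1 := ent_joint_pair (A := A) hm hk (fun ω => (A ω, E ω)) fun _ _ h => (Prod.ext_iff.1 h).1
  have h2 := ent_joint_pair (A := A) hm hk (fun ω => (A ω, B ω)) fun _ _ h => (Prod.ext_iff.1 h).1
  rw [channelValue, cent, cent,
    ent_congr (X := fun z : 𝒰 × Ω => (A z.2, z.1, E z.2)) (Y := fun z => (z.1, A z.2, E z.2))
      fun z z' => by simp only [Prod.ext_iff]; tauto,
    ent_congr (X := fun z : 𝒰 × Ω => (A z.2, z.1, B z.2)) (Y := fun z => (z.1, A z.2, B z.2))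
      fun z z' => by simp only [Prod.ext_iff]; tauto, h1, h2]
  ring

lemma ent_joint_eq_sum [Fintype 𝒰] [Fintype T] (k : S → 𝒰 → ℝ) (B : Ω → T) :
    ent (joint m A k) (fun z => (z.1, B z.2)) =
      ∑ u, ∑ b, tilt m A B (fun a => k a u) b * -Real.logb 2 (tilt m A B (fun a => k a u) b) := by
  have h : ∀ u b, push (joint m A k) (fun z => (z.1, B z.2)) (u, b) =
      tilt m A B (fun a => k a u) b := by
    classical
    intro u b
    simp only [push, pr, tilt, joint, Prod.ext_iff]
    rw [Fintype.sum_prod_type_right]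
    refine sum_congr rfl fun ω _ => ?_
    by_cases hb : B ω = b <;> simp [hb]
  rw [ent, ← sum_push_mul (fun z : 𝒰 × Ω => (z.1, B z.2))
    fun x => -Real.logb 2 (push (joint m A k) (fun z => (z.1, B z.2)) x), Fintype.sum_prod_type]
  simp only [h]

lemma channelValue_eq_sum [Fintype 𝒰] [Fintype T] [Fintype R] (hm : m ∈ stdSimplex ℝ Ω)
    {k : S → 𝒰 → ℝ} (hk : ∀ a, k a ∈ stdSimplex ℝ 𝒰) :
    channelValue m A B E k = ∑ u, columnValue m A B E (fun a => k a u) +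
      (ent m (fun ω => (A ω, E ω)) - ent m (fun ω => (A ω, B ω))) := by
  rw [channelValue_eq_ent hm hk, ent_joint_eq_sum, ent_joint_eq_sum,
    ← sum_sub_distrib]
  rfl

lemma tilt_smul (t : ℝ) (w : S → ℝ) (b : T) : tilt m A B (t • w) b = t * tilt m A B w b := by
  simp only [tilt, mul_sum]
  refine sum_congr rfl fun ω _ => ?_
  split_ifs
  · simp; ring
  · simp

lemma sum_tilt [Fintype T] (w : S → ℝ) : ∑ b, tilt m A B w b = ∑ ω, m ω * w (A ω) := by
  classical
  simp only [tilt]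
  rw [sum_comm]
  exact sum_congr rfl fun ω _ => by simp

lemma mul_mul_neg_logb (t x : ℝ) :
    t * x * -Real.logb 2 (t * x) = t * (x * -Real.logb 2 x) + t * -Real.logb 2 t * x := by
  by_cases ht : t = 0
  · simp [ht]
  by_cases hx : x = 0
  · simp [hx]
  rw [Real.logb_mul ht hx]; ring

/-- Column values are homogeneous, because the columns of `B` and of `E` have the same mass. -/
lemma columnValue_smul [Fintype T] [Fintype R] (t : ℝ) (w : S → ℝ) :
    columnValue m A B E (t • w) = t * columnValue m A B E w := by
  simp only [columnValue, tilt_smul, mul_mul_neg_logb, sum_add_distrib, ← mul_sum, sum_tilt]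
  ring

lemma continuous_tilt (B : Ω → T) (b : T) : Continuous fun w : S → ℝ => tilt m A B w b := by
  refine continuous_finsetSum _ fun ω _ => ?_
  split_ifs <;> fun_prop

lemma continuous_mul_neg_logb : Continuous fun x : ℝ => x * -Real.logb 2 x := by
  have h : (fun x : ℝ => x * -Real.logb 2 x) = fun x => Real.negMulLog x / Real.log 2 := by
    ext x; rw [Real.negMulLog, Real.logb]; ring
  rw [h]
  exact Real.continuous_negMulLog.div_const _

lemma continuous_columnValue [Fintype T] [Fintype R] :
    Continuous (columnValue m A B E) := by
  exact (continuous_finsetSum _ fun b _ => continuous_mul_neg_logb.comp (continuous_tilt B b)).sub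
    (continuous_finsetSum _ fun e _ => continuous_mul_neg_logb.comp (continuous_tilt E e))

/-- Carathéodory's argument for a homogeneous functional `G`: as long as there are more than
`|S| + 1` columns, the vectors `(w i, G (w i))` are linearly dependent, and rescaling the columns
along a dependency removes one of them without changing either sum. -/
lemma exists_columns [Fintype S] (G : (S → ℝ) → ℝ) (hG : ∀ (t : ℝ) w, G (t • w) = t * G w) (n : ℕ)
    (w : Fin n → S → ℝ) (hw : ∀ i a, 0 ≤ w i a) :
    ∃ w' : Fin (Fintype.card S + 1) → S → ℝ, (∀ i a, 0 ≤ w' i a) ∧ ∑ i, w' i = ∑ i, w i ∧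
      ∑ i, G (w' i) = ∑ i, G (w i) := by
  induction n with
  | zero =>
    refine ⟨fun _ => 0, by simp, by simp, ?_⟩
    have : G 0 = 0 := by simpa using hG 0 0
    simp [this]
  | succ n ih =>
    have hG0 : G 0 = 0 := by simpa using hG 0 0
    rcases le_or_gt (n + 1) (Fintype.card S + 1) with hn | hn
    · obtain ⟨d, hd⟩ := Nat.exists_eq_add_of_le hn
      rw [hd]
      refine ⟨Fin.append w fun _ => 0, fun i a => ?_, ?_, ?_⟩
      · refine Fin.addCases (fun j => ?_) (fun j => ?_) i
        · simpa using hw j a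
        · simp
      · simp [Fin.sum_univ_add]
      · simp [Fin.sum_univ_add, hG0]
    · have hdep : ¬ LinearIndependent ℝ fun i => ((w i, G (w i)) : (S → ℝ) × ℝ) := fun h => by
        have := h.fintype_card_le_finrank
        simp at this
        omega
      obtain ⟨g₀, hg₀, i₀, hi₀⟩ := Fintype.not_linearIndependent_iff.1 hdep
      obtain ⟨g, hg, hgpos⟩ : ∃ g : Fin (n + 1) → ℝ,
          ∑ i, g i • ((w i, G (w i)) : (S → ℝ) × ℝ) = 0 ∧ ∃ i, 0 < g i := by
        rcases hi₀.lt_or_gt with h | h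
        · exact ⟨fun i => -g₀ i, by simp only [neg_smul, sum_neg_distrib, hg₀, neg_zero], i₀,
            by simpa using h⟩
        · exact ⟨g₀, hg₀, i₀, h⟩
      -- scaling by `1 - g i / g j` keeps all columns nonnegative and kills column `j`
      obtain ⟨j, hj⟩ := Finite.exists_max g
      have hgj : 0 < g j := let ⟨i, hi⟩ := hgpos; hi.trans_le (hj i)
      set w₁ : Fin (n + 1) → S → ℝ := fun i => (1 - g i / g j) • w i with hw₁
      have hg1 : ∑ i, g i • w i = 0 := by simpa [Prod.fst_sum] using congrArg Prod.fst hg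
      have hg2 : ∑ i, g i * G (w i) = 0 := by simpa [Prod.snd_sum] using congrArg Prod.snd hg
      have hs1 : ∑ i, w₁ i = ∑ i, w i := by
        simp only [hw₁, sub_smul, sum_sub_distrib, one_smul, div_eq_inv_mul, mul_smul, ← smul_sum,
          hg1, smul_zero, sub_zero]
      have hs2 : ∑ i, G (w₁ i) = ∑ i, G (w i) := by
        simp only [hw₁, hG, sub_mul, sum_sub_distrib, one_mul, div_eq_inv_mul, mul_assoc, ← mul_sum,
          hg2, mul_zero, sub_zero]
      have hj0 : w₁ j = 0 := by simp [hw₁, hgj.ne']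
      obtain ⟨w', h1, h2, h3⟩ := ih (fun i => w₁ (j.succAbove i)) fun i a => by
        refine mul_nonneg (sub_nonneg.2 ?_) (hw _ _)
        rw [div_le_one hgj]
        exact hj _
      refine ⟨w', h1, ?_, ?_⟩
      · rw [h2, ← hs1, Fin.sum_univ_succAbove _ j, hj0, zero_add]
      · rw [h3, ← hs2, Fin.sum_univ_succAbove _ j, hj0, hG0, zero_add]

/-- Among channels with any number of outputs, one with `|S| + 1` outputs has the largest value. -/
lemma exists_optimal_channel [Fintype S] [Fintype T] [Fintype R] (hm : m ∈ stdSimplex ℝ Ω) :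
    ∃ k₀ : S → Fin (Fintype.card S + 1) → ℝ, (∀ a, k₀ a ∈ stdSimplex ℝ _) ∧
      ∀ (n : ℕ) (k : S → Fin n → ℝ), (∀ a, k a ∈ stdSimplex ℝ (Fin n)) →
        channelValue m A B E k ≤ channelValue m A B E k₀ := by
  set D : Set (S → Fin (Fintype.card S + 1) → ℝ) := Set.univ.pi fun _ => stdSimplex ℝ _ with hD
  have hcomp : IsCompact D := isCompact_univ_pi fun _ => isCompact_stdSimplex _ _
  have hne : D.Nonempty := ⟨fun _ => Pi.single 0 1, fun _ _ => single_mem_stdSimplex ℝ 0⟩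
  have hcont : Continuous fun k : S → Fin (Fintype.card S + 1) → ℝ =>
      ∑ u, columnValue m A B E (fun a => k a u) :=
    continuous_finsetSum _ fun u _ => continuous_columnValue.comp (by fun_prop)
  obtain ⟨k₀, hk₀, hmax⟩ := hcomp.exists_isMaxOn hne hcont.continuousOn
  have hk₀' : ∀ a, k₀ a ∈ stdSimplex ℝ _ := fun a => hk₀ a trivial
  refine ⟨k₀, hk₀', fun n k hk => ?_⟩
  obtain ⟨w, hw0, hw1, hw2⟩ := exists_columns (columnValue m A B E) columnValue_smul n
    (fun u a => k a u) fun u a => (hk a).1 u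
  have hwD : (fun a u => w u a) ∈ D := fun a _ => by
    refine ⟨fun u => hw0 u a, ?_⟩
    have := congrFun hw1 a
    simpa [(hk a).2] using this
  rw [channelValue_eq_sum hm hk, channelValue_eq_sum hm hk₀', ← hw2]
  have := hmax hwD
  simpa using this

lemma channelValue_le_of_fin [Fintype 𝒰] [Fintype T] [Fintype R] (hm : m ∈ stdSimplex ℝ Ω) {x : ℝ}
    (hx : ∀ (n : ℕ) (k : S → Fin n → ℝ), (∀ a, k a ∈ stdSimplex ℝ (Fin n)) →
      channelValue m A B E k ≤ x) {k : S → 𝒰 → ℝ} (hk : ∀ a, k a ∈ stdSimplex ℝ 𝒰) :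
    channelValue m A B E k ≤ x := by
  have hk' : ∀ a, (fun i => k a ((Fintype.equivFin 𝒰).symm i)) ∈ stdSimplex ℝ _ := fun a =>
    ⟨fun i => (hk a).1 _, by rw [(Fintype.equivFin 𝒰).symm.sum_comp, (hk a).2]⟩
  refine le_trans (le_of_eq ?_) (hx _ _ hk')
  rw [channelValue_eq_sum hm hk, channelValue_eq_sum hm hk',
    (Fintype.equivFin 𝒰).symm.sum_comp fun u => columnValue m A B E (fun a => k a u)]

/-- Channels of full support come arbitrarily close to any channel in value. -/
lemma exists_full_support [Fintype 𝒰] [Nonempty 𝒰] [Fintype T] [Fintype R]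
    (hm : m ∈ stdSimplex ℝ Ω) {k : S → 𝒰 → ℝ} (hk : ∀ a, k a ∈ stdSimplex ℝ 𝒰) {ε : ℝ}
    (hε : 0 < ε) :
    ∃ k' : S → 𝒰 → ℝ, (∀ a, k' a ∈ stdSimplex ℝ 𝒰) ∧ (∀ a u, 0 < k' a u) ∧
      channelValue m A B E k - ε ≤ channelValue m A B E k' := by
  have hc : (0:ℝ) < Fintype.card 𝒰 := by exact_mod_cast Fintype.card_pos
  let κ : ℝ → S → 𝒰 → ℝ := fun t a u => (1 - t) * k a u + t * (Fintype.card 𝒰 : ℝ)⁻¹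
  have hcont : Continuous fun t => ∑ u, columnValue m A B E (fun a => κ t a u) :=
    continuous_finsetSum _ fun u _ => continuous_columnValue.comp (by fun_prop)
  have hev := (hcont.tendsto 0).eventually (lt_mem_nhds (sub_lt_self _ hε))
  obtain ⟨t, ht0, ht, ht1⟩ : ∃ t : ℝ, 0 < t ∧ _ ∧ t < 1 :=
    ((hev.filter_mono nhdsWithin_le_nhds).and
      (Ioo_mem_nhdsGT one_pos : Set.Ioo (0:ℝ) 1 ∈ nhdsWithin 0 (Set.Ioi 0))).exists.imp
        fun t h => ⟨h.2.1, h.1, h.2.2⟩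
  have hκ : ∀ a, κ t a ∈ stdSimplex ℝ 𝒰 := fun a => by
    refine ⟨fun u => add_nonneg (mul_nonneg (by linarith) ((hk a).1 u)) (by positivity), ?_⟩
    simp only [κ, sum_add_distrib, ← mul_sum, (hk a).2]
    simp [hc.ne']
  refine ⟨κ t, hκ, fun a u => add_pos_of_nonneg_of_pos
    (mul_nonneg (by linarith) ((hk a).1 u)) (by positivity), ?_⟩
  rw [channelValue_eq_sum hm hk, channelValue_eq_sum hm hκ]
  have h0 : ∀ a u, κ 0 a u = k a u := fun a u => by simp [κ]
  simp only [h0] at ht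
  linarith

end Region

/-! ### The single-letter converse -/

section Converse

variable {Ω S T R W : Type*} [Fintype Ω] {m : Ω → ℝ}

/-- The single-letter auxiliary variable of the converse is memoryless in the sense needed: jointly
with the letter `ω i`, it is the output of a channel whose input is `A (ω i)` only. The channel
substitutes its input `a` for the `i`-th source letter in an independent word. -/
lemma push_coordinate_eq_joint {N : ℕ} {𝒱 : Type*} (hm : m ∈ stdSimplex ℝ Ω) (A : Ω → S)
    (i : Fin N) (v : S → (Fin N → Ω) → 𝒱)
    (hv : ∀ a ω x, v a (Function.update ω i x) = v a ω) :
    push (pw m) (fun ω : Fin N → Ω => (v (A (ω i)) ω, ω i)) =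
      joint m A fun a => push (pw m) (v a) := by
  classical
  ext ⟨y, x⟩
  simp only [push, pr_eq_sum_mul]
  rw [sum_pw_update hm.2 i]
  simp only [Function.update_self, hv, joint, push, pr_eq_sum_mul, mul_sum]
  refine sum_congr rfl fun ω _ => ?_
  rw [sum_eq_single x]
  · simp only [Prod.ext_iff, and_true]
    ring
  · intro z _ hz
    simp [Prod.ext_iff, hz]
  · simp

variable [Fintype T] [Fintype R] [Fintype W]

/-- The single-letter bound. With `V i = (J, B^{<i}, E^{>i})`, the difference
`H(J, B^N) - H(J, E^N)` telescopes into `∑ i, H(V i, B i) - H(V i, E i)`. -/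
lemma cent_sub_cent_le (hm : m ∈ stdSimplex ℝ Ω) (A : Ω → S) (B : Ω → T) (E : Ω → R) {x : ℝ}
    (hx : ∀ (n : ℕ) (k : S → Fin n → ℝ), (∀ a, k a ∈ stdSimplex ℝ (Fin n)) →
      channelValue m A B E k ≤ x) {N : ℕ} (f : (Fin N → S) → W) :
    cent (pw m) (fun (ω : Fin N → Ω) i => A (ω i))
        (fun ω => (f fun i => A (ω i), fun i => E (ω i))) -
      cent (pw m) (fun (ω : Fin N → Ω) i => A (ω i))
        (fun ω => (f fun i => A (ω i), fun i => B (ω i))) ≤ N * x := by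
  classical
  have hpm := pw_mem (ι := Fin N) hm
  obtain ⟨ω₀⟩ : Nonempty Ω := by
    by_contra h
    rw [not_nonempty_iff] at h
    simpa using hm.2
  -- the interpolation between `(J, E^N)` and `(J, B^N)`
  let Z : ℕ → (Fin N → Ω) → W × (Fin N → T) × (Fin N → R) := fun l ω =>
    (f fun i => A (ω i), fun j => if j.1 < l then B (ω j) else B ω₀,
      fun j => if l ≤ j.1 then E (ω j) else E ω₀)
  let v : Fin N → S → (Fin N → Ω) → W × (Fin N → T) × (Fin N → R) := fun i a ω =>
    (f (Function.update (fun j => A (ω j)) i a), fun j => if j < i then B (ω j) else B ω₀,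
      fun j => if i < j then E (ω j) else E ω₀)
  have hv : ∀ i a ω y, v i a (Function.update ω i y) = v i a ω := by
    intro i a ω y
    refine Prod.ext ?_ (Prod.ext ?_ ?_)
    · simp only [v]
      congr 1
      ext j
      by_cases h : j = i
      · subst h; simp
      · simp [h]
    · ext j
      by_cases h : j = i
      · subst h; simp [v]
      · simp [v, h]
    · ext j
      by_cases h : j = i
      · subst h; simp [v]
      · simp [v, h]
  have hstep : ∀ i : Fin N, ent (pw m) (Z (i + 1)) - ent (pw m) (Z i) +
      (ent m (fun ω => (A ω, E ω)) - ent m (fun ω => (A ω, B ω))) ≤ x := by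
    intro i
    have hk : ∀ a, push (pw m) (v i a) ∈ stdSimplex ℝ _ := fun a => push_mem hpm _
    have h := channelValue_le_of_fin hm hx hk
    rw [channelValue_eq_ent hm hk, ← push_coordinate_eq_joint hm A i (v i) (hv i)] at h
    rw [ent_push, ent_push] at h
    have hself : ∀ ω : Fin N → Ω, Function.update (fun j => A (ω j)) i (A (ω i)) =
        fun j => A (ω j) := fun ω => Function.update_eq_self i fun j => A (ω j)
    have h1 : ent (pw m) (Z (i + 1)) = ent (pw m) fun ω => (v i (A (ω i)) ω, B (ω i)) := by
      refine ent_congr fun ω ω' => ?_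
      simp only [Z, v, Prod.ext_iff, hself, funext_iff]
      constructor
      · rintro ⟨ha, hb, he⟩
        refine ⟨⟨ha, fun j => ?_, fun j => ?_⟩, ?_⟩
        · split_ifs with hj
          · simpa [show j.1 < i.1 + 1 by omega] using hb j
          · rfl
        · split_ifs with hj
          · simpa [show i.1 + 1 ≤ j.1 by omega] using he j
          · rfl
        · simpa using hb i
      · rintro ⟨⟨ha, hb, he⟩, hi⟩
        refine ⟨ha, fun j => ?_, fun j => ?_⟩
        · split_ifs with hj
          · rcases (Nat.lt_succ_iff.1 hj).lt_or_eq with h' | h'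
            · simpa [show j < i from h'] using hb j
            · rw [Fin.ext h']; exact hi
          · rfl
        · split_ifs with hj
          · simpa [show i < j from hj] using he j
          · rfl
    have h2 : ent (pw m) (Z i) = ent (pw m) fun ω => (v i (A (ω i)) ω, E (ω i)) := by
      refine ent_congr fun ω ω' => ?_
      simp only [Z, v, Prod.ext_iff, hself, funext_iff]
      constructor
      · rintro ⟨ha, hb, he⟩
        refine ⟨⟨ha, fun j => ?_, fun j => ?_⟩, ?_⟩
        · split_ifs with hj
          · simpa [show j.1 < i.1 from hj] using hb j
          · rfl
        · split_ifs with hj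
          · simpa [show i.1 ≤ j.1 by omega] using he j
          · rfl
        · simpa using he i
      · rintro ⟨⟨ha, hb, he⟩, hi⟩
        refine ⟨ha, fun j => ?_, fun j => ?_⟩
        · split_ifs with hj
          · simpa [show j < i from hj] using hb j
          · rfl
        · split_ifs with hj
          · rcases hj.lt_or_eq with h' | h'
            · simpa [show i < j from h'] using he j
            · rw [← Fin.ext h']; exact hi
          · rfl
    rw [h1, h2]
    exact h
  have hsum := sum_le_sum fun i (_ : i ∈ (univ : Finset (Fin N))) => hstep i
  rw [sum_add_distrib, Fin.sum_univ_eq_sum_range fun l => ent (pw m) (Z (l + 1)) - ent (pw m) (Z l),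
    sum_range_sub fun l => ent (pw m) (Z l)] at hsum
  simp only [sum_const, card_univ, Fintype.card_fin, nsmul_eq_mul] at hsum
  have hZN : ent (pw m) (Z N) = ent (pw m) fun ω => (f fun i => A (ω i), fun i => B (ω i)) := by
    refine ent_congr fun ω ω' => ?_
    simp [Z, Prod.ext_iff, funext_iff, fun j : Fin N => Nat.not_le.2 j.isLt]
  have hZ0 : ent (pw m) (Z 0) = ent (pw m) fun ω => (f fun i => A (ω i), fun i => E (ω i)) := by
    refine ent_congr fun ω ω' => ?_
    simp [Z, Prod.ext_iff, funext_iff]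
  have hAE := ent_pw (ι := Fin N) hm fun ω => (A ω, E ω)
  have hAB := ent_pw (ι := Fin N) hm fun ω => (A ω, B ω)
  rw [Fintype.card_fin] at hAE hAB
  rw [cent, cent, ← hZN, ← hZ0,
    ent_congr (X := fun ω : Fin N → Ω => (fun i => A (ω i), f fun i => A (ω i), fun i => E (ω i)))
      (Y := fun (ω : Fin N → Ω) i => (A (ω i), E (ω i))), hAE,
    ent_congr (X := fun ω : Fin N → Ω => (fun i => A (ω i), f fun i => A (ω i), fun i => B (ω i)))
      (Y := fun (ω : Fin N → Ω) i => (A (ω i), B (ω i))), hAB]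
  · linarith
  all_goals
    intro ω ω'
    simp only [Prod.ext_iff, funext_iff, forall_and]
    exact ⟨fun h => ⟨h.1, h.2.2⟩, fun h => ⟨h.1, congrArg f (funext h.1), h.2⟩⟩

variable [Fintype S]

/-- The loss in the converse caused by an error probability `ε`, per letter. -/
noncomputable def fanoLoss (S : Type*) [Fintype S] (ε : ℝ) : ℝ :=
  -Real.logb 2 (1 - ε) + ε * -Real.logb 2 ε + ε * Real.logb 2 (Fintype.card S)

lemma tendsto_fanoLoss : Filter.Tendsto (fun ε => ε + fanoLoss S ε) (nhdsWithin 0 (Set.Ioi 0))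
    (nhds 0) := by
  have h1 : ContinuousAt (fun ε : ℝ => -Real.logb 2 (1 - ε)) 0 := by
    have : ContinuousAt (fun ε : ℝ => Real.log (1 - ε)) 0 :=
      ContinuousAt.log (by fun_prop) (by norm_num)
    exact (this.div_const _).neg
  have h3 : ContinuousAt (fun ε : ℝ => ε + fanoLoss S ε) 0 :=
    continuousAt_id.add ((h1.add continuous_mul_neg_logb.continuousAt).add
      (continuousAt_id.mul continuousAt_const))
  have h4 := h3.tendsto
  simp only [fanoLoss, sub_zero, Real.logb_one, neg_zero, zero_mul, add_zero] at h4
  exact h4.mono_left nhdsWithin_le_nhds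

/-- Fano's inequality for a block code. As `1 ≤ N`, the loss is proportional to `N` even in its
constant terms, so that no lower bound on the block length is needed. -/
lemma cent_le_fanoLoss (hm : m ∈ stdSimplex ℝ Ω) (A : Ω → S) (B : Ω → T) {N : ℕ} (hN : 1 ≤ N)
    (f : (Fin N → S) → W) (g : W × (Fin N → T) → (Fin N → S)) {ε : ℝ} (h0 : 0 < ε) (h1 : ε < 1)
    (hg : pr (pw m) (fun ω : Fin N → Ω => g (f fun i => A (ω i), fun i => B (ω i)) ≠
      fun i => A (ω i)) ≤ ε) :
    cent (pw m) (fun (ω : Fin N → Ω) i => A (ω i))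
      (fun ω => (f fun i => A (ω i), fun i => B (ω i))) ≤ N * fanoLoss S ε := by
  have h := fano (pw_mem (ι := Fin N) hm) (fun ω i => A (ω i))
    (fun ω => (f fun i => A (ω i), fun i => B (ω i))) g h0 h1 hg
  refine h.trans ?_
  have hN' : (1:ℝ) ≤ N := by exact_mod_cast hN
  have hl1 : 0 ≤ -Real.logb 2 (1 - ε) := by
    rw [neg_nonneg]
    exact Real.logb_nonpos one_lt_two (by linarith) (by linarith)
  have hl2 : 0 ≤ ε * -Real.logb 2 ε := by
    refine mul_nonneg h0.le ?_
    rw [neg_nonneg]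
    exact Real.logb_nonpos one_lt_two (by linarith) (by linarith)
  simp only [fanoLoss, mul_add, Fintype.card_fun, Fintype.card_fin, Nat.cast_pow, Real.logb_pow]
  have h2 := le_mul_of_one_le_left hl1 hN'
  have h3 := le_mul_of_one_le_left hl2 hN'
  linarith

/-- The rate of a code is at least `H(A | B)`, up to the Fano loss. -/
lemma cent_le_rate (hm : m ∈ stdSimplex ℝ Ω) (A : Ω → S) (B : Ω → T) {N : ℕ} (hN : 1 ≤ N)
    {K : ℕ} {r : ℝ} (hK : (K : ℝ) ≤ (2:ℝ) ^ (N * r))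
    (f : (Fin N → S) → Fin K) (g : Fin K × (Fin N → T) → (Fin N → S)) {ε : ℝ} (h0 : 0 < ε)
    (h1 : ε < 1)
    (hg : pr (pw m) (fun ω : Fin N → Ω => g (f fun i => A (ω i), fun i => B (ω i)) ≠
      fun i => A (ω i)) ≤ ε) :
    cent m A B ≤ r + fanoLoss S ε := by
  have hpm := pw_mem (ι := Fin N) hm
  have hfano := cent_le_fanoLoss hm A B hN f g h0 h1 hg
  rw [cent_of_function (fun (ω : Fin N → Ω) i => A (ω i)) f (fun ω i => B (ω i)), cent_pw hm,
    Fintype.card_fin] at hfano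
  have hK0 : 0 < K := by
    by_contra h
    have hK0 : K = 0 := by omega
    subst hK0
    have : IsEmpty (Fin N → Ω) := ⟨fun ω => (f fun i => A (ω i)).elim0⟩
    simpa using hpm.2
  have hcard := cent_le_logb_card hpm (fun ω : Fin N → Ω => f fun i => A (ω i))
    (fun ω i => B (ω i))
  rw [Fintype.card_fin] at hcard
  have hlog : Real.logb 2 K ≤ N * r := by
    rwa [Real.logb_le_iff_le_rpow one_lt_two (by exact_mod_cast hK0)]
  have hN' : (0:ℝ) < N := by exact_mod_cast hN
  refine le_of_mul_le_mul_left ?_ hN'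
  linarith

end Converse

/-! ### Probability mass functions and auxiliary variables -/

section Interface

variable {Ω X S T V : Type*}

/-- The real weights of a probability mass function. -/
noncomputable def wt (p : PMF Ω) (ω : Ω) : ℝ := (p ω).toReal

lemma wt_mem [Fintype Ω] (p : PMF Ω) : wt p ∈ stdSimplex ℝ Ω := by
  refine ⟨fun ω => ENNReal.toReal_nonneg, ?_⟩
  have h := p.tsum_coe
  rw [tsum_fintype] at h
  simp only [wt]
  rw [← ENNReal.toReal_sum fun ω _ => p.apply_ne_top ω, h, ENNReal.toReal_one]

/-- The probability mass function with given real weights. -/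
noncomputable def ofWeights [Fintype Ω] (m : Ω → ℝ) (hm : m ∈ stdSimplex ℝ Ω) : PMF Ω :=
  PMF.ofFintype (fun ω => ENNReal.ofReal (m ω)) (by
    rw [← ENNReal.ofReal_sum_of_nonneg fun ω _ => hm.1 ω, hm.2, ENNReal.ofReal_one])

lemma wt_ofWeights [Fintype Ω] {m : Ω → ℝ} (hm : m ∈ stdSimplex ℝ Ω) :
    wt (ofWeights m hm) = m := by
  ext ω
  simp [wt, ofWeights, ENNReal.toReal_ofReal (hm.1 ω)]

lemma prob_eq_pr [Fintype Ω] (p : PMF Ω) (P : Ω → Prop) : prob p {ω | P ω} = pr (wt p) P := by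
  classical
  rw [prob, PMF.toOuterMeasure_apply_fintype, ENNReal.toReal_sum, pr]
  · refine sum_congr rfl fun ω _ => ?_
    by_cases h : P ω <;> simp [h, wt]
  · intro ω _
    by_cases h : P ω <;> simp [h, p.apply_ne_top]

lemma condEntropy_eq_cent [Fintype Ω] [Fintype S] [Fintype T] (p : PMF Ω) (X : Ω → S)
    (Y : Ω → T) : condEntropy p X Y = cent (wt p) X Y := by
  have hm := wt_mem p
  have h1 : ∀ x y, prob p {ω | X ω = x ∧ Y ω = y} = push (wt p) (fun ω => (X ω, Y ω)) (x, y) := by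
    intro x y
    rw [prob_eq_pr]
    simp only [push, Prod.ext_iff]
  have h2 : ∀ y, prob p {ω | Y ω = y} = push (wt p) Y y := fun y => prob_eq_pr p _
  have h3 := sum_push_mul (m := wt p) (fun ω => (X ω, Y ω)) fun z => Real.logb 2
    (push (wt p) (fun ω => (X ω, Y ω)) z / push (wt p) Y z.2)
  rw [Fintype.sum_prod_type] at h3
  simp only [condEntropy, h1, h2]
  rw [h3, cent, ent, ent, ← sum_sub_distrib, ← sum_neg_distrib]
  refine sum_congr rfl fun ω _ => ?_
  rcases (hm.1 ω).eq_or_lt with h0 | h0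
  · simp [← h0]
  rw [Real.logb_div (push_pos hm.1 (fun ω => (X ω, Y ω)) h0).ne' (push_pos hm.1 Y h0).ne']
  ring

lemma wt_iid [Fintype X] (p : PMF X) (N : ℕ) : wt (iid p N) = pw (wt p) := by
  ext ω
  simp [wt, iid, pw, ENNReal.toReal_prod]

lemma wt_map [Fintype Ω] [Fintype X] (q : PMF Ω) (f : Ω → X) : wt (q.map f) = push (wt q) f := by
  classical
  ext x
  simp only [wt, PMF.map_apply, push, pr]
  rw [tsum_fintype, ENNReal.toReal_sum]
  · refine sum_congr rfl fun ω _ => ?_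
    by_cases h : f ω = x
    · simp [h]
    · simp [h, Ne.symm h]
  · intro ω _
    split_ifs <;> simp [q.apply_ne_top]

end Interface

section Auxiliary

variable {𝒜 ℬ ℰ 𝒰 : Type*} [Fintype 𝒜] [Fintype ℬ] [Fintype ℰ] [Fintype 𝒰]

lemma condMutualInfo_sub_eq (q : PMF (𝒰 × 𝒜 × ℬ × ℰ)) :
    condMutualInfo q (fun ω => ω.2.1) (fun ω => ω.2.2.1) (fun ω => ω.1)
        - condMutualInfo q (fun ω => ω.2.1) (fun ω => ω.2.2.2) (fun ω => ω.1) =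
      cent (wt q) (fun ω => ω.2.1) (fun ω => (ω.1, ω.2.2.2)) -
        cent (wt q) (fun ω => ω.2.1) (fun ω => (ω.1, ω.2.2.1)) := by
  simp only [condMutualInfo, condEntropy_eq_cent, cent]
  rw [ent_congr (X := fun ω : 𝒰 × 𝒜 × ℬ × ℰ => (ω.2.1, ω.2.2.1, ω.1))
      (Y := fun ω => (ω.2.1, ω.1, ω.2.2.1)) fun _ _ => by simp only [Prod.ext_iff]; tauto,
    ent_congr (X := fun ω : 𝒰 × 𝒜 × ℬ × ℰ => (ω.2.1, ω.2.2.2, ω.1))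
      (Y := fun ω => (ω.2.1, ω.1, ω.2.2.2)) fun _ _ => by simp only [Prod.ext_iff]; tauto,
    ent_congr (X := fun ω : 𝒰 × 𝒜 × ℬ × ℰ => (ω.2.2.1, ω.1))
      (Y := fun ω => (ω.1, ω.2.2.1)) fun _ _ => by simp only [Prod.ext_iff]; tauto,
    ent_congr (X := fun ω : 𝒰 × 𝒜 × ℬ × ℰ => (ω.2.2.2, ω.1))
      (Y := fun ω => (ω.1, ω.2.2.2)) fun _ _ => by simp only [Prod.ext_iff]; tauto]
  ring

/-- The law of an auxiliary variable is the joint law of a channel with input `A`. -/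
lemma IsAuxiliary.exists_channel {p : PMF (𝒜 × ℬ × ℰ)} {q : PMF (𝒰 × 𝒜 × ℬ × ℰ)}
    (hq : IsAuxiliary p q) :
    ∃ k : 𝒜 → 𝒰 → ℝ, (∀ a, k a ∈ stdSimplex ℝ 𝒰) ∧
      wt q = joint (wt p) (fun ω => ω.1) k := by
  classical
  have hqm := wt_mem q
  have hsnd : push (wt q) Prod.snd = wt p := by rw [← wt_map, hq.1]
  obtain ⟨u₀⟩ : Nonempty 𝒰 := by
    by_contra h
    rw [not_nonempty_iff] at h
    simpa using hqm.2
  set PA : 𝒜 → ℝ := push (wt q) fun ω => ω.2.1 with hPA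
  set PUA : 𝒰 × 𝒜 → ℝ := push (wt q) fun ω => (ω.1, ω.2.1) with hPUA
  have hsum : ∀ a, ∑ u, PUA (u, a) = PA a := by
    intro a
    simp only [hPUA, hPA, push, pr, Prod.ext_iff]
    rw [sum_comm]
    refine sum_congr rfl fun ω _ => ?_
    by_cases h : ω.2.1 = a <;> simp [h]
  refine ⟨fun a => if PA a = 0 then Pi.single u₀ 1 else fun u => PUA (u, a) / PA a,
    fun a => ?_, ?_⟩
  · dsimp only
    split_ifs with h
    · exact single_mem_stdSimplex ℝ u₀
    · refine ⟨fun u => div_nonneg (push_nonneg hqm.1 _ _) (push_nonneg hqm.1 _ _), ?_⟩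
      rw [← sum_div, hsum, div_self h]
  · -- where `P(A = a)` vanishes, so do both sides, whatever the value of the channel there
    ext ⟨u, a, z⟩
    have hmk := hq.2 u a z
    simp only [prob_eq_pr] at hmk
    have h1 : pr (wt q) (fun ω => ω.1 = u ∧ ω.2.1 = a ∧ ω.2.2 = z) = wt q (u, a, z) := by
      rw [← congrFun (push_id (m := wt q)) (u, a, z)]
      simp only [push, Prod.ext_iff]
    have h2 : pr (wt q) (fun ω => ω.2.1 = a ∧ ω.2.2 = z) = wt p (a, z) := by
      rw [← hsnd]
      simp only [push, Prod.ext_iff]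
    have h3 : pr (wt q) (fun ω => ω.1 = u ∧ ω.2.1 = a) = PUA (u, a) := by
      simp only [hPUA, push, Prod.ext_iff]
    rw [h1, h2, h3] at hmk
    change wt q (u, a, z) * PA a = _ at hmk
    simp only [joint]
    by_cases h : PA a = 0
    · have h4 := le_push hqm.1 (fun ω => ω.2.1) (u, a, z)
      have h5 : wt p (a, z) ≤ PA a := by
        rw [← h2]
        exact pr_mono hqm.1 fun ω _ hω => hω.1
      have h6 := hqm.1 (u, a, z)
      have h7 := (wt_mem p).1 (a, z)
      change wt q (u, a, z) ≤ PA a at h4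
      rw [le_antisymm (h4.trans h.le) h6, le_antisymm (h5.trans h.le) h7, zero_mul]
    · rw [if_neg h, mul_div_assoc', eq_div_iff h, hmk, mul_comm]

/-- Conversely, every channel with input `A` defines an auxiliary variable. -/
lemma isAuxiliary_ofWeights (p : PMF (𝒜 × ℬ × ℰ)) {k : 𝒜 → 𝒰 → ℝ}
    (hk : ∀ a, k a ∈ stdSimplex ℝ 𝒰) :
    IsAuxiliary p (ofWeights (joint (wt p) (fun ω => ω.1) k) (joint_mem (wt_mem p) hk)) := by
  classical
  set J := joint (wt p) (fun ω => ω.1) k with hJ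
  have hJm : J ∈ stdSimplex ℝ (𝒰 × 𝒜 × ℬ × ℰ) := joint_mem (wt_mem p) hk
  have hsnd : push J Prod.snd = wt p := by
    have := push_joint_snd (m := wt p) (A := fun ω => ω.1) hk fun ω => ω
    rwa [push_id] at this
  constructor
  · ext x
    have h := congrFun (wt_map (ofWeights J hJm) Prod.snd) x
    rw [wt_ofWeights, hsnd] at h
    exact (ENNReal.toReal_eq_toReal_iff' (PMF.apply_ne_top _ _) (PMF.apply_ne_top _ _)).1 h
  · intro u a z
    simp only [prob_eq_pr, wt_ofWeights]
    have h1 : pr J (fun ω => ω.1 = u ∧ ω.2.1 = a ∧ ω.2.2 = z) = wt p (a, z) * k a u := by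
      trans J (u, a, z)
      · rw [← congrFun (push_id (m := J)) (u, a, z)]
        simp only [push, Prod.ext_iff]
      · rfl
    have h2 : pr J (fun ω => ω.2.1 = a ∧ ω.2.2 = z) = wt p (a, z) := by
      rw [← hsnd]
      simp only [push, Prod.ext_iff]
    have h3 : pr J (fun ω => ω.2.1 = a) = push (wt p) (fun ω => ω.1) a :=
      congrFun (push_joint_snd (m := wt p) (A := fun ω => ω.1) hk fun ω => ω.1) a
    have h4 : pr J (fun ω => ω.1 = u ∧ ω.2.1 = a) = push (wt p) (fun ω => ω.1) a * k a u := by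
      simp only [pr, push, sum_mul]
      rw [Fintype.sum_prod_type_right]
      refine sum_congr rfl fun ω _ => ?_
      by_cases h : ω.1 = a
      · simp [h, hJ, joint]
      · simp [h]
    rw [h1, h2, h3, h4]
    ring

lemma mem_equivocationValues_iff (p : PMF (𝒜 × ℬ × ℰ)) (r : ℝ) :
    r ∈ equivocationValues p ↔ ∃ n : ℕ, n ≤ Fintype.card 𝒜 + 1 ∧ ∃ k : 𝒜 → Fin n → ℝ,
      (∀ a, k a ∈ stdSimplex ℝ (Fin n)) ∧
        r = channelValue (wt p) (fun ω => ω.1) (fun ω => ω.2.1) (fun ω => ω.2.2) k := by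
  constructor
  · rintro ⟨n, hn, q, hq, rfl⟩
    obtain ⟨k, hk, hqk⟩ := hq.exists_channel
    refine ⟨n, hn, k, hk, ?_⟩
    rw [condMutualInfo_sub_eq, hqk]
    rfl
  · rintro ⟨n, hn, k, hk, rfl⟩
    refine ⟨n, hn, _, isAuxiliary_ofWeights p hk, ?_⟩
    rw [condMutualInfo_sub_eq, wt_ofWeights]
    rfl

end Auxiliary

/-! ### Both halves of the coding theorem -/

section Main

variable {𝒜 ℬ ℰ : Type*} [Fintype 𝒜] [Fintype ℬ] [Fintype ℰ]

lemma Code.errorProb_eq {R : ℝ} {N : ℕ} (c : Code 𝒜 ℬ R N) (p : PMF (𝒜 × ℬ × ℰ)) :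
    c.errorProb p = pr (pw (wt p)) fun ω : Fin N → 𝒜 × ℬ × ℰ =>
      c.dec (c.enc fun i => (ω i).1, fun i => (ω i).2.1) ≠ fun i => (ω i).1 := by
  rw [Code.errorProb, prob_eq_pr, wt_iid]
  rfl

lemma Code.equivocation_eq {R : ℝ} {N : ℕ} (c : Code 𝒜 ℬ R N) (p : PMF (𝒜 × ℬ × ℰ)) :
    c.equivocation p = cent (pw (wt p)) (fun (ω : Fin N → 𝒜 × ℬ × ℰ) i => (ω i).1)
      fun ω => (c.enc fun i => (ω i).1, fun i => (ω i).2.2) := by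
  rw [Code.equivocation, condEntropy_eq_cent, wt_iid]
  rfl

/-- The direct part, for any auxiliary channel. -/
lemma achievable_of_channel (p : PMF (𝒜 × ℬ × ℰ)) {n : ℕ} {k : 𝒜 → Fin n → ℝ}
    (hk : ∀ a, k a ∈ stdSimplex ℝ (Fin n)) {R Δ : ℝ}
    (hR : cent (wt p) (fun ω => ω.1) (fun ω => ω.2.1) ≤ R)
    (hΔ : Δ ≤ channelValue (wt p) (fun ω => ω.1) (fun ω => ω.2.1) (fun ω => ω.2.2) k) :
    Achievable p R Δ := by
  intro ε hε
  have hm := wt_mem p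
  obtain ⟨ω₀, -⟩ := p.support_nonempty
  have : Nonempty (Fin n) := by
    by_contra h
    rw [not_nonempty_iff] at h
    simpa using (hk ω₀.1).2
  obtain ⟨k', hk', hkp, hval⟩ := exists_full_support (A := fun ω : 𝒜 × ℬ × ℰ => ω.1)
    (B := fun ω => ω.2.1) (E := fun ω => ω.2.2) hm hk (half_pos hε)
  obtain ⟨L, hL, K, hK, f, g, herr, heq⟩ := exists_code_of_channel (A := fun ω : 𝒜 × ℬ × ℰ => ω.1)
    hm hk' hkp (fun ω => ω.2.1) (fun ω => ω.2.2) (half_pos hε)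
  have hL0 : (0:ℝ) ≤ L := L.cast_nonneg
  have hKf : K ≤ ⌊(2 : ℝ) ^ ((L : ℝ) * (R + ε))⌋₊ := by
    refine Nat.le_floor (hK.trans (Real.rpow_le_rpow_of_exponent_le one_le_two ?_))
    exact mul_le_mul_of_nonneg_left (by linarith) hL0
  let c : Code 𝒜 ℬ (R + ε) L :=
    { enc := fun a => Fin.castLE hKf (f a)
      dec := fun jb => if h : jb.1.1 < K then g ⟨jb.1.1, h⟩ jb.2 else fun _ => ω₀.1 }
  refine ⟨L, hL, c, ?_, ?_⟩
  · rw [c.equivocation_eq]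
    have h1 : cent (pw (wt p)) (fun (ω : Fin L → 𝒜 × ℬ × ℰ) i => (ω i).1)
        (fun ω => (c.enc fun i => (ω i).1, fun i => (ω i).2.2)) =
        cent (pw (wt p)) (fun (ω : Fin L → 𝒜 × ℬ × ℰ) i => (ω i).1)
        (fun ω => (f fun i => (ω i).1, fun i => (ω i).2.2)) := by
      rw [cent, cent]
      congr 1 <;> refine ent_congr fun ω ω' => ?_ <;>
        simp only [c, Prod.ext_iff, (Fin.castLE_injective hKf).eq_iff]
    rw [h1]
    refine le_trans (mul_le_mul_of_nonneg_left ?_ hL0) heq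
    change Δ - ε ≤ channelValue (wt p) (fun ω => ω.1) (fun ω => ω.2.1) (fun ω => ω.2.2) k' - ε / 2
    linarith
  · rw [c.errorProb_eq]
    refine lt_of_le_of_lt (le_trans (pr_mono (pw_mem hm).1 fun ω _ h => ?_) herr) (half_lt_self hε)
    simpa [c] using h

/-- The converse part, for any upper bound on the values of the auxiliary channels. -/
lemma le_of_achievable (p : PMF (𝒜 × ℬ × ℰ)) {x : ℝ}
    (hx : ∀ (n : ℕ) (k : 𝒜 → Fin n → ℝ), (∀ a, k a ∈ stdSimplex ℝ (Fin n)) →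
      channelValue (wt p) (fun ω => ω.1) (fun ω => ω.2.1) (fun ω => ω.2.2) k ≤ x)
    {R Δ : ℝ} (h : Achievable p R Δ) :
    cent (wt p) (fun ω => ω.1) (fun ω => ω.2.1) ≤ R ∧ Δ ≤ x := by
  have hm := wt_mem p
  have key : ∀ ε : ℝ, 0 < ε → ε < 1 →
      cent (wt p) (fun ω => ω.1) (fun ω => ω.2.1) ≤ R + (ε + fanoLoss 𝒜 ε) ∧
        Δ ≤ x + (ε + fanoLoss 𝒜 ε) := by
    intro ε h0 h1
    obtain ⟨N, hN, c, heq, herr⟩ := h ε h0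
    rw [c.errorProb_eq] at herr
    rw [c.equivocation_eq] at heq
    have hrate := cent_le_rate hm (fun ω => ω.1) (fun ω => ω.2.1) hN
      (Nat.floor_le (by positivity)) c.enc c.dec h0 h1 herr.le
    have hfano := cent_le_fanoLoss hm (fun ω => ω.1) (fun ω => ω.2.1) hN c.enc c.dec h0 h1 herr.le
    have hsingle := cent_sub_cent_le hm (fun ω => ω.1) (fun ω => ω.2.1) (fun ω => ω.2.2) hx c.enc
    refine ⟨by linarith, ?_⟩
    have hN' : (0:ℝ) < N := by exact_mod_cast hN
    refine le_of_mul_le_mul_left ?_ hN'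
    linarith
  have hev : ∀ᶠ ε : ℝ in nhdsWithin 0 (Set.Ioi 0), ε ∈ Set.Ioo (0:ℝ) 1 := Ioo_mem_nhdsGT one_pos
  constructor
  · have ht := (tendsto_fanoLoss (S := 𝒜)).const_add R
    rw [add_zero] at ht
    exact ge_of_tendsto ht (hev.mono fun ε hε => (key ε hε.1 hε.2).1)
  · have ht := (tendsto_fanoLoss (S := 𝒜)).const_add x
    rw [add_zero] at ht
    exact ge_of_tendsto ht (hev.mono fun ε hε => (key ε hε.1 hε.2).2)

end Main

end SecureCompression

theorem corollary1 {𝒜 ℬ ℰ : Type*} [Fintype 𝒜] [Fintype ℬ] [Fintype ℰ]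
    (p : PMF (𝒜 × ℬ × ℰ)) :
    ∃ Δmax : ℝ, IsGreatest (SecureCompression.equivocationValues p) Δmax ∧
      ∀ R Δ : ℝ, SecureCompression.Achievable p R Δ ↔
        SecureCompression.condEntropy p (fun ω => ω.1) (fun ω => ω.2.1) ≤ R ∧ Δ ≤ Δmax := by
  obtain ⟨k₀, hk₀, hmax⟩ := SecureCompression.exists_optimal_channel
    (A := fun ω : 𝒜 × ℬ × ℰ => ω.1) (B := fun ω => ω.2.1) (E := fun ω => ω.2.2)
    (SecureCompression.wt_mem p)
  refine ⟨_, ⟨(SecureCompression.mem_equivocationValues_iff p _).2 ⟨_, le_rfl, k₀, hk₀, rfl⟩, ?_⟩,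
    fun R Δ => ?_⟩
  · intro r hr
    obtain ⟨n, -, k, hk, rfl⟩ := (SecureCompression.mem_equivocationValues_iff p r).1 hr
    exact hmax n k hk
  · rw [SecureCompression.condEntropy_eq_cent]
    exact ⟨SecureCompression.le_of_achievable p hmax,
      fun h => SecureCompression.achievable_of_channel p hk₀ h.1 h.2⟩
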